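/- Let $n\ge 0$ be an integer and $m>0$. Let $\mathbb{M}^{1,n}=\mathbb{R}\times\mathbb{R}^n$ be Minkowski space with form $X\cdot Y=-X^0Y^0+\sum_i X^iY^i$, and let $H^n$ be its future unit hyperboloid, parametrised by $\mathbf{y}\in\mathbb{R}^n$ through $\tilde P(\mathbf{y})=(\sqrt{1+\mathbf{y}^2},\mathbf{y})$, with metric $h=\big(\delta_{\alpha\beta}-\frac{y_\alpha y_\beta}{1+\mathbf{y}^2}\big)dy^\alpha dy^\beta$. Let $\mathrm{Ti}=\mathbb{R}\times H^n$, with coordinates $(u,\mathbf{y})$, carry the Carrollian structure $(h,\partial_u)$, where $h$ is pulled back to $\mathrm{Ti}$, and let the SPI group be the group of orientation preserving diffeomorphisms of $\mathrm{Ti}$ that preserve $h$ and $\partial_u$. To a function $a:H^n\to\mathbb{C}$ (the Fourier coefficients of a massive scalar field) one associates the field $$\Phi_a(X)=\frac{m^{n-1}}{2(2\pi)^n}\int\frac{d^n\mathbf{k}}{\sqrt{1+\mathbf{k}^2}}\Big(a(\mathbf{k})e^{im\tilde P(\mathbf{k})\cdot X}+\overline{a(\mathbf{k})}e^{-im\tilde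 P(\mathbf{k})\cdot X}\Big)$$ (whenever $a$ is integrable for $d^n\mathbf{k}/\sqrt{1+\mathbf{k}^2}$) and the scattering data on $\mathrm{Ti}$ $$\varphi_a(u,\mathbf{y})=\frac{m^{n/2-1}}{2(2\pi)^{n/2}}\,a(\mathbf{y})\,e^{-imu}.$$ Then: 1. The elements of the SPI group are exactly the maps $(u,\mathbf{y})\mapsto(u+\omega(\mathbf{y}),\mathbf{y}'(\mathbf{y}))$ with $\omega\in C^\infty(H^n,\mathbb{R})$ and $\mathbf{y}\mapsto\mathbf{y}'$ an orientation preserving isometric diffeomorphism of $H^n$. 2. A function $\varphi:\mathrm{Ti}\to\mathbb{C}$ satisfies $(\mathcal{L}_{\partial_u}+im)\varphi=0$ if and only if $\varphi=\varphi_a$ for a unique $a$. The SPI group acts on such functions by pullback, that is by $\varphi(u,\mathbf{y})\mapsto\varphi(u+\omega(\mathbf{y}),\mathbf{y}'(\mathbf{y}))$; it preserves the equation, and $\varphi_a$ is mapped to $\varphi_{a'}$ if and only if $a'(\mathbf{y})=a(\mathbf{y}')e^{-im\omega(\mathbf{y})}$ for all $\mathbf{y}$. 3. Let $\mathcal{H}$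 be the Hilbert space of (classes of) measurable $a$ with $$\|a\|^2=\frac{m^{n-1}}{2(2\pi)^n}\int\frac{d^n\mathbf{k}}{\sqrt{1+\mathbf{k}^2}}\,|a(\mathbf{k})|^2<\infty .$$ There is a homomorphism $U$ from the SPI group to the unitary group of $\mathcal{H}$ such that, for $F:(u,\mathbf{y})\mapsto(u+\omega(\mathbf{y}),\mathbf{y}'(\mathbf{y}))$ in the SPI group, $(U(F^{-1})a)(\mathbf{y})=a(\mathbf{y}')e^{-im\omega(\mathbf{y})}$ almost everywhere. This representation is irreducible: every closed invariant subspace is $0$ or $\mathcal{H}$. 4. $U$ extends the massive (spin zero) representation of the Poincaré group. The Poincaré group of maps $g:X\mapsto\Lambda X+T$, with $T\in\mathbb{R}^{n+1}$ and $\Lambda$ in the identity component of $O(1,n)$, embeds into the SPI group by an injective homomorphism $\iota$, where $\iota(g)(u,\mathbf{y})=(u-T\cdot\tilde P(\mathbf{y}'),\mathbf{y}')$ and $\tilde P(\mathbf{y}')=\Lambda\tilde P(\mathbf{y})$. For $a\in\mathcal{H}$, $(U(\iota(g))a)(\mathbf{y})=e^{-imT\cdot\tilde P(\mathbf{y})}a(\Lambda^{-1}\mathbf{y})$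 almost everywhere, where $\tilde P(\Lambda^{-1}\mathbf{y})=\Lambda^{-1}\tilde P(\mathbf{y})$; and if $a$ is moreover integrable for $d^n\mathbf{k}/\sqrt{1+\mathbf{k}^2}$, then $\Phi_{U(\iota(g))a}(X)=\Phi_a(g^{-1}X)$ for all $X\in\mathbb{M}^{1,n}$. -/

import Mathlib

open scoped ContDiff

noncomputable section

namespace SpiMassive

/-- The hyperbolic space `H^n`, i.e. the future unit hyperboloid of `(n+1)`-dimensional Minkowski
space, described in its global chart `y ∈ ℝ^n`; see `momentum` for the parametrisation. -/
abbrev Hyp (n : ℕ) : Type := EuclideanSpace ℝ (Fin n)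

/-- The extended boundary at future time-like infinity, in its canonical global
coordinates `(u, y) ∈ ℝ × H^n`. -/
abbrev Ti (n : ℕ) : Type := ℝ × Hyp n

/-- `(n+1)`-dimensional Minkowski space: time component and spatial component. -/
abbrev Mink (n : ℕ) : Type := ℝ × EuclideanSpace ℝ (Fin n)

variable {n : ℕ}

/-- The Minkowski form, with signature `(-, +, …, +)`. -/
def mink (X Y : Mink n) : ℝ := -(X.1 * Y.1) + inner ℝ X.2 Y.2

/-- The point `(√(1 + y²), y)` of the future unit hyperboloid with coordinate `y`. -/
def momentum (y : Hyp n) : Mink n := (Real.sqrt (1 + ‖y‖ ^ 2), y)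

/-- The hyperbolic metric `h = (δ_{αβ} - y_α y_β / (1 + |y|²)) dy^α dy^β`. -/
def hypMetric (y v w : Hyp n) : ℝ :=
  inner ℝ v w - inner ℝ y v * inner ℝ y w / (1 + ‖y‖ ^ 2)

/-- The degenerate Carrollian metric on `Ti`, the pullback of `h` by `(u, y) ↦ y`. -/
def carrollMetric (p v w : Ti n) : ℝ := hypMetric p.2 v.2 w.2

/-- The Carrollian (constant) vector field `∂_u` on `Ti`. -/
def carrollField (n : ℕ) : Ti n := (1, 0)

/-- Orientation preserving isometric diffeomorphisms of `H^n`. -/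
structure IsOrientedIsometry (ψ : Equiv.Perm (Hyp n)) : Prop where
  smooth : ContDiff ℝ ∞ ψ
  smooth_symm : ContDiff ℝ ∞ ψ.symm
  metric : ∀ y v w, hypMetric (ψ y) (fderiv ℝ ψ y v) (fderiv ℝ ψ y w) = hypMetric y v w
  orient : ∀ y, 0 < (fderiv ℝ ψ y).det

/-- Orientation preserving automorphisms of the Carrollian geometry of `Ti`: diffeomorphisms
that preserve the degenerate metric and the vector field `∂_u`. -/
structure IsCarrollAut (F : Equiv.Perm (Ti n)) : Prop where
  smooth : ContDiff ℝ ∞ F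
  smooth_symm : ContDiff ℝ ∞ F.symm
  metric : ∀ p v w, carrollMetric (F p) (fderiv ℝ F p v) (fderiv ℝ F p w) = carrollMetric p v w
  field : ∀ p, fderiv ℝ F p (carrollField n) = carrollField n
  orient : ∀ p, 0 < (fderiv ℝ F p).det

theorem IsCarrollAut.one : IsCarrollAut (1 : Equiv.Perm (Ti n)) := by
  have h : ((1 : Equiv.Perm (Ti n)) : Ti n → Ti n) = id := rfl
  refine ⟨by rw [h]; exact contDiff_id, ?_, ?_, ?_, ?_⟩
  · have h' : ((1 : Equiv.Perm (Ti n)).symm : Ti n → Ti n) = id := rfl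
    rw [h']; exact contDiff_id
  · intro p v w; rw [h, fderiv_id]; rfl
  · intro p; rw [h, fderiv_id]; rfl
  · intro p; rw [h, fderiv_id]
    simp [ContinuousLinearMap.det]

theorem IsCarrollAut.mul {F G : Equiv.Perm (Ti n)} (hF : IsCarrollAut F) (hG : IsCarrollAut G) :
    IsCarrollAut (F * G) := by
  have h : ((F * G : Equiv.Perm (Ti n)) : Ti n → Ti n) = F ∘ G := rfl
  have h' : ((F * G : Equiv.Perm (Ti n)).symm : Ti n → Ti n) = G.symm ∘ F.symm := rfl
  have hd : ∀ p, fderiv ℝ (F ∘ G) p = (fderiv ℝ F (G p)).comp (fderiv ℝ G p) := fun p =>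
    fderiv_comp p (hF.smooth.differentiable (by simp) _) (hG.smooth.differentiable (by simp) _)
  refine ⟨by rw [h]; exact hF.smooth.comp hG.smooth,
    by rw [h']; exact hG.smooth_symm.comp hF.smooth_symm, ?_, ?_, ?_⟩
  · intro p v w
    rw [h, hd]
    simp only [Function.comp, ContinuousLinearMap.comp_apply]
    rw [hF.metric, hG.metric]
  · intro p
    rw [h, hd, ContinuousLinearMap.comp_apply, hG.field, hF.field]
  · intro p
    rw [h, hd]
    simp only [ContinuousLinearMap.det, ContinuousLinearMap.toLinearMap_comp, LinearMap.det_comp]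
    exact mul_pos (hF.orient _) (hG.orient _)

theorem IsCarrollAut.inv {F : Equiv.Perm (Ti n)} (hF : IsCarrollAut F) : IsCarrollAut F⁻¹ := by
  have h : ((F⁻¹ : Equiv.Perm (Ti n)) : Ti n → Ti n) = F.symm := rfl
  have h' : ((F⁻¹ : Equiv.Perm (Ti n)).symm : Ti n → Ti n) = F := rfl
  have hd : ∀ p, (fderiv ℝ F (F.symm p)).comp (fderiv ℝ F.symm p)
      = ContinuousLinearMap.id ℝ (Ti n) := fun p => by
    rw [← fderiv_comp p (hF.smooth.differentiable (by simp) _)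
      (hF.smooth_symm.differentiable (by simp) _)]
    have : (F ∘ F.symm : Ti n → Ti n) = id := by ext1 x; simp
    rw [this, fderiv_id]
  have hd' : ∀ p, (fderiv ℝ F.symm p).comp (fderiv ℝ F (F.symm p))
      = ContinuousLinearMap.id ℝ (Ti n) := fun p => by
    have h1 := fderiv_comp (F.symm p) (f := F) (g := F.symm)
      (hF.smooth_symm.differentiable (by simp) _) (hF.smooth.differentiable (by simp) _)
    rw [F.apply_symm_apply] at h1
    rw [← h1]
    have : (F.symm ∘ F : Ti n → Ti n) = id := by ext1 x; simp
    rw [this, fderiv_id]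
  refine ⟨by rw [h]; exact hF.smooth_symm, by rw [h']; exact hF.smooth, ?_, ?_, ?_⟩
  · intro p v w
    rw [h]
    have key := hF.metric (F.symm p) (fderiv ℝ F.symm p v) (fderiv ℝ F.symm p w)
    have e : ∀ x, fderiv ℝ F (F.symm p) (fderiv ℝ F.symm p x) = x := fun x =>
      congrArg (fun L : Ti n →L[ℝ] Ti n => L x) (hd p)
    rw [e, e, F.apply_symm_apply] at key
    exact key.symm
  · intro p
    rw [h]
    have e : fderiv ℝ F.symm p (fderiv ℝ F (F.symm p) (carrollField n)) = carrollField n :=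
      congrArg (fun L : Ti n →L[ℝ] Ti n => L (carrollField n)) (hd' p)
    rwa [hF.field] at e
  · intro p
    rw [h]
    have e : (fderiv ℝ F (F.symm p)).det * (fderiv ℝ F.symm p).det = 1 := by
      have := congrArg ContinuousLinearMap.det (hd p)
      simpa [ContinuousLinearMap.det, ContinuousLinearMap.toLinearMap_comp,
        LinearMap.det_comp] using this
    have hpos := hF.orient (F.symm p)
    by_contra hc
    nlinarith [mul_nonneg hpos.le (neg_nonneg.mpr (not_lt.mp hc))]

/-- The SPI group: the (orientation preserving) automorphism group of the Carrollian
geometry of `Ti`. -/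
def SPI (n : ℕ) : Subgroup (Equiv.Perm (Ti n)) where
  carrier := {F | IsCarrollAut F}
  one_mem' := IsCarrollAut.one
  mul_mem' := fun hF hG => hF.mul hG
  inv_mem' := fun hF => hF.inv

/-- The action of a transformation of `Ti` on functions on `Ti`, by pullback. -/
def pull (F : Equiv.Perm (Ti n)) (φ : Ti n → ℂ) : Ti n → ℂ := fun p => φ (F p)

/-- The scattering data `φ(u, y) = m^{n/2-1} / (2 (2π)^{n/2}) a(y) e^{-imu}` on `Ti` of the massive
field with Fourier coefficients `a`. -/
def scatteringData (m : ℝ) (a : Hyp n → ℂ) : Ti n → ℂ := fun p =>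
  ((m ^ ((n : ℝ) / 2 - 1) / (2 * (2 * Real.pi) ^ ((n : ℝ) / 2)) : ℝ) : ℂ) * a p.2
    * Complex.exp (-(Complex.I * m * p.1))

/-- The equation `(𝓛_{∂_u} + i m) φ = 0` on functions on `Ti`. -/
def IsEquivariantData (m : ℝ) (φ : Ti n → ℂ) : Prop :=
  ∀ (u : ℝ) (y : Hyp n),
    HasDerivAt (fun s : ℝ => φ (s, y)) (-(Complex.I * m) * φ (u, y)) u

/-- The normalised invariant measure `m^{n-1} / (2 (2π)^n) d^n k / √(1 + k²)`. -/
def massMeasure (m : ℝ) (n : ℕ) : MeasureTheory.Measure (Hyp n) :=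
  MeasureTheory.volume.withDensity fun k =>
    ENNReal.ofReal (m ^ ((n : ℝ) - 1) / (2 * (2 * Real.pi) ^ n) / Real.sqrt (1 + ‖k‖ ^ 2))

/-- The one-particle Hilbert space of Fourier coefficients of finite norm. -/
abbrev MassiveL2 (m : ℝ) (n : ℕ) : Type := MeasureTheory.Lp ℂ 2 (massMeasure m n)

/-- The massive scalar field with Fourier coefficients `a`:
`Φ(X) = m^{n-1} / (2 (2π)^n) ∫ d^n k / √(1 + k²) (a(k) e^{i m P(k)·X} + c.c.)`. -/
def massiveField (m : ℝ) (a : Hyp n → ℂ) (X : Mink n) : ℂ :=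
  ∫ k, (a k * Complex.exp (Complex.I * m * mink (momentum k) X)
    + star (a k) * Complex.exp (-(Complex.I * m * mink (momentum k) X))) ∂(massMeasure m n)

theorem mink_momentum (y : Hyp n) : mink (momentum y) (momentum y) = -1 := by
  have : (0 : ℝ) ≤ 1 + ‖y‖ ^ 2 := by positivity
  simp only [mink, momentum, Real.mul_self_sqrt this, real_inner_self_eq_norm_sq]
  ring

/-- Future-directed unit time-like vectors lie on the hyperboloid. -/
theorem eq_momentum {X : Mink n} (h : mink X X = -1) (hX : 0 < X.1) : X = momentum X.2 := by
  simp only [mink, real_inner_self_eq_norm_sq] at h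
  refine Prod.ext ?_ rfl
  have : 1 + ‖X.2‖ ^ 2 = X.1 ^ 2 := by linarith
  simp only [momentum]
  rw [this, Real.sqrt_sq hX.le]

/-- The proper orthochronous Lorentz group (the identity component of `O(1, n)`): linear
automorphisms of determinant one of Minkowski space that preserve the Minkowski form and map the
future unit hyperboloid to future-directed vectors. -/
def Lorentz (n : ℕ) : Subgroup (Mink n ≃ₗ[ℝ] Mink n) where
  carrier := {L | (∀ X Y, mink (L X) (L Y) = mink X Y) ∧
    LinearMap.det (L : Mink n →ₗ[ℝ] Mink n) = 1 ∧ ∀ y, 0 < (L (momentum y)).1}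
  one_mem' := by
    refine ⟨fun _ _ => rfl, LinearMap.det_id, fun y => ?_⟩
    change 0 < Real.sqrt (1 + ‖y‖ ^ 2)
    positivity
  mul_mem' := by
    rintro L K ⟨hL, hLd, hLp⟩ ⟨hK, hKd, hKp⟩
    refine ⟨fun X Y => ?_, ?_, fun y => ?_⟩
    · change mink (L (K X)) (L (K Y)) = _
      rw [hL, hK]
    · change LinearMap.det ((L : Mink n →ₗ[ℝ] Mink n) ∘ₗ (K : Mink n →ₗ[ℝ] Mink n)) = 1
      rw [LinearMap.det_comp, hLd, hKd, one_mul]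
    · change 0 < (L (K (momentum y))).1
      rw [eq_momentum (by rw [hK, mink_momentum]) (hKp y)]
      exact hLp _
  inv_mem' := by
    rintro L ⟨hL, hLd, hLp⟩
    have hinv : ∀ X Y, mink (L.symm X) (L.symm Y) = mink X Y := fun X Y => by
      rw [← hL, L.apply_symm_apply, L.apply_symm_apply]
    refine ⟨hinv, ?_, fun y => ?_⟩
    · have h := LinearEquiv.det_mul_det_symm L
      rw [hLd, one_mul] at h
      exact h
    · change 0 < (L.symm (momentum y)).1
      have h1 : mink (L.symm (momentum y)) (L.symm (momentum y)) = -1 := by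
        rw [hinv, mink_momentum]
      by_contra hc
      rcases lt_or_eq_of_le (not_lt.mp hc) with hlt | heq
      · have h2 : -(L.symm (momentum y)) = momentum (-(L.symm (momentum y))).2 := by
          apply eq_momentum
          · simpa [mink] using h1
          · simpa using hlt
        have h3 := hLp (-(L.symm (momentum y))).2
        rw [← h2, map_neg, L.apply_symm_apply] at h3
        have h4 : 0 < (momentum y).1 := by
          change 0 < Real.sqrt (1 + ‖y‖ ^ 2)
          positivity
        simp only [Prod.fst_neg] at h3
        linarith
      · simp only [mink, heq, real_inner_self_eq_norm_sq] at h1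
        nlinarith [sq_nonneg ‖(L.symm (momentum y)).2‖]

/-- The Poincaré group: affine automorphisms `X ↦ Λ X + T` of Minkowski space with `Λ` in the
Lorentz group. -/
def Poincare (n : ℕ) : Subgroup (Mink n ≃ᵃ[ℝ] Mink n) :=
  (Lorentz n).comap AffineEquiv.linearHom

end SpiMassive

end

noncomputable section

namespace SpiMassive

variable {n : ℕ}

/-! ### The structure of the SPI group -/

/-! An automorphism preserves `∂_u`, so it commutes with translation in `u` and has the form `(u +
ω(y), ψ(y))`. Its derivative is block triangular with a `1` in the `u` direction, so the metric and
orientation conditions on `Ti` become exactly those on `ψ`. The equation for `φ` is an ODE in `u`,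
whose solutions are `φ(0, y) e^{-imu}`. Unitarity holds because the Jacobian of an oriented isometry
is a ratio of densities of the hyperbolic volume, so `massMeasure` is invariant
(`IsOrientedIsometry.measurePreserving`), and because supertranslations act by phases. For
irreducibility, take `a` in a closed invariant subspace and `b` orthogonal to it; every `⟨b, U(F)
a⟩` vanishes. With `ψ` fixed and the supertranslation varying, differentiation in the
supertranslation gives `a(ψ y) · conj b(y) = 0` almost everywhere
(`ae_eq_zero_or_of_forall_inner_pullL2`). Now let `ψ` run through a family of transvections indexed
by `p ∈ ℝ^n`. If `b ≠ 0`, Fubini gives one `y` with `b(y) ≠ 0` and `a(ψ_p y) = 0` for almost all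
`p`. Since `p ↦ ψ_p y` is differentiable and onto, it carries null sets to null sets, so `a = 0`
(`ae_eq_zero_or_ae_eq_zero_of_transvections`). Lorentz transformations act on the hyperboloid by
oriented isometries, and a translation `T` acts by the supertranslation `-T·P(y')`. Covariance of
the field is an invariant change of variables in the momentum integral. -/

theorem det_shear_prod (l : Hyp n →L[ℝ] ℝ) (M : Hyp n →L[ℝ] Hyp n) :
    ((ContinuousLinearMap.fst ℝ ℝ (Hyp n) + l.comp (ContinuousLinearMap.snd ℝ ℝ (Hyp n))).prod
      (M.comp (ContinuousLinearMap.snd ℝ ℝ (Hyp n)))).det = M.det := by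
  have h : (((ContinuousLinearMap.fst ℝ ℝ (Hyp n) +
      l.comp (ContinuousLinearMap.snd ℝ ℝ (Hyp n))).prod
      (M.comp (ContinuousLinearMap.snd ℝ ℝ (Hyp n))) : Ti n →L[ℝ] Ti n) : Ti n →ₗ[ℝ] Ti n)
      -- The transvection has determinant one because `l ∘ snd` vanishes on its direction `(1, 0)`.
      = (LinearMap.prodMap LinearMap.id (M : Hyp n →ₗ[ℝ] Hyp n)) ∘ₗ
        LinearMap.transvection ((l : Hyp n →ₗ[ℝ] ℝ) ∘ₗ LinearMap.snd ℝ ℝ (Hyp n))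
          ((1, 0) : ℝ × Hyp n) := by
    refine LinearMap.ext fun x => ?_
    simp [LinearMap.transvection.apply]
  rw [ContinuousLinearMap.det, h, LinearMap.det_comp, LinearMap.transvection.det]
  rw [LinearMap.det_prodMap]
  simp [ContinuousLinearMap.det]

/-- The curve `s ↦ F(s, y) - (s, 0)` has velocity `∂_u - ∂_u = 0`, hence is constant. -/
theorem IsCarrollAut.apply_eq {F : Equiv.Perm (Ti n)} (hF : IsCarrollAut F) (u : ℝ) (y : Hyp n) :
    F (u, y) = (u + (F (0, y)).1, (F (0, y)).2) := by
  have h : ∀ s : ℝ, HasDerivAt (fun s : ℝ => F (s, y) - (s, (0 : Hyp n))) 0 s := by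
    intro s
    have h1 : HasDerivAt (fun s : ℝ => ((s, y) : Ti n)) (carrollField n) s :=
      (hasDerivAt_id s).prodMk (hasDerivAt_const s y)
    have h2 : HasDerivAt (fun s : ℝ => ((s, (0 : Hyp n)) : Ti n)) (carrollField n) s :=
      (hasDerivAt_id s).prodMk (hasDerivAt_const s 0)
    have h3 := ((hF.smooth.differentiable (by simp) (s, y)).hasFDerivAt).comp_hasDerivAt s h1
    rw [hF.field] at h3
    have h4 := h3.sub h2
    rw [sub_self] at h4
    exact h4
  have key := is_const_of_deriv_eq_zero (fun s => (h s).differentiableAt)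
    (fun s => (h s).deriv) u 0
  simp only [Prod.mk_zero_zero, sub_zero] at key
  rw [sub_eq_iff_eq_add] at key
  rw [key]
  exact Prod.ext (add_comm _ _) (add_zero _)

/-- The transformation of `H^n` induced by an automorphism of `Ti`. -/
def baseMap (F : SPI n) : Equiv.Perm (Hyp n) where
  toFun y := (F.1 (0, y)).2
  invFun y := (F.1.symm (0, y)).2
  left_inv y := by
    have h := IsCarrollAut.apply_eq F.2.inv (F.1 (0, y)).1 (F.1 (0, y)).2
    exact (congrArg Prod.snd h).symm.trans (congrArg Prod.snd (F.1.symm_apply_apply (0, y)))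
  right_inv y := by
    have h := IsCarrollAut.apply_eq F.2 (F.1.symm (0, y)).1 (F.1.symm (0, y)).2
    exact (congrArg Prod.snd h).symm.trans (congrArg Prod.snd (F.1.apply_symm_apply (0, y)))

/-- The supertranslation part of an automorphism of `Ti`. -/
def shift (F : SPI n) (y : Hyp n) : ℝ := (F.1 (0, y)).1

theorem spi_apply (F : SPI n) (u : ℝ) (y : Hyp n) : F.1 (u, y) = (u + shift F y, baseMap F y) :=
  IsCarrollAut.apply_eq F.2 u y

theorem contDiff_section : ContDiff ℝ ∞ fun y : Hyp n => ((0, y) : Ti n) :=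
  contDiff_const.prodMk contDiff_id

theorem contDiff_shift (F : SPI n) : ContDiff ℝ ∞ (shift F) :=
  contDiff_fst.comp (F.2.smooth.comp contDiff_section)

theorem hasFDerivAt_fibred {F : Ti n → Ti n} {w : Hyp n → ℝ} {ψ : Hyp n → Hyp n}
    (h : ∀ u y, F (u, y) = (u + w y, ψ y)) (hw : ContDiff ℝ ∞ w) (hψ : ContDiff ℝ ∞ ψ)
    (p : Ti n) :
    HasFDerivAt F ((ContinuousLinearMap.fst ℝ ℝ (Hyp n) +
      (fderiv ℝ w p.2).comp (ContinuousLinearMap.snd ℝ ℝ (Hyp n))).prod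
      ((fderiv ℝ ψ p.2).comp (ContinuousLinearMap.snd ℝ ℝ (Hyp n)))) p := by
  have hF : F = fun p : Ti n => (p.1 + w p.2, ψ p.2) := funext fun p => h p.1 p.2
  rw [hF]
  have h1 := ((hw.differentiable (by simp) p.2).hasFDerivAt).comp p
    (hasFDerivAt_snd (𝕜 := ℝ) (p := p))
  have h2 := ((hψ.differentiable (by simp) p.2).hasFDerivAt).comp p
    (hasFDerivAt_snd (𝕜 := ℝ) (p := p))
  exact (hasFDerivAt_fst.add h1).prodMk h2

/-- The degenerate metric sees only base components, so testing it on vectors `(0, v)` loses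
nothing. The determinant upstairs is that of the base derivative. -/
theorem isOrientedIsometry_baseMap (F : SPI n) : IsOrientedIsometry (baseMap F) := by
  have hs : ContDiff ℝ ∞ (baseMap F) := contDiff_snd.comp (F.2.smooth.comp contDiff_section)
  have hd : ∀ p, fderiv ℝ F.1 p = _ := fun p =>
    (hasFDerivAt_fibred (spi_apply F) (contDiff_shift F) hs p).fderiv
  refine ⟨hs, contDiff_snd.comp (F.2.smooth_symm.comp contDiff_section), ?_, ?_⟩
  · intro y v w
    have h := F.2.metric (0, y) (0, v) (0, w)
    rw [hd] at h
    exact h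
  · intro y
    have h := F.2.orient (0, y)
    rwa [hd, det_shear_prod] at h

theorem isCarrollAut_of_fibred {F : Equiv.Perm (Ti n)} {w : Hyp n → ℝ} {ψ : Equiv.Perm (Hyp n)}
    (hw : ContDiff ℝ ∞ w) (hψ : IsOrientedIsometry ψ) (h : ∀ u y, F (u, y) = (u + w y, ψ y)) :
    IsCarrollAut F := by
  have hd : ∀ p, fderiv ℝ F p = _ := fun p => (hasFDerivAt_fibred h hw hψ.smooth p).fderiv
  have hF : (F : Ti n → Ti n) = fun p : Ti n => (p.1 + w p.2, ψ p.2) := funext fun p => h p.1 p.2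
  have hF' : (F.symm : Ti n → Ti n) = fun p : Ti n => (p.1 - w (ψ.symm p.2), ψ.symm p.2) := by
    funext p
    rw [Equiv.symm_apply_eq, h]
    simp
  have hs : ContDiff ℝ ∞ fun p : Ti n => ψ.symm p.2 := hψ.smooth_symm.comp contDiff_snd
  refine ⟨?_, ?_, ?_, ?_, ?_⟩
  · rw [hF]
    exact (contDiff_fst.add (hw.comp contDiff_snd)).prodMk (hψ.smooth.comp contDiff_snd)
  · rw [hF']
    exact (contDiff_fst.sub (hw.comp hs)).prodMk hs
  · intro p v v'
    have h2 : (F p).2 = ψ p.2 := by rw [hF]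
    rw [hd, carrollMetric, h2]
    exact hψ.metric p.2 v.2 v'.2
  · intro p
    rw [hd]
    simp [carrollField]
  · intro p
    rw [hd, det_shear_prod]
    exact hψ.orient _

theorem mem_SPI_iff (F : Equiv.Perm (Ti n)) : F ∈ SPI n ↔
    ∃ (w : Hyp n → ℝ) (ψ : Equiv.Perm (Hyp n)),
      ContDiff ℝ ∞ w ∧ IsOrientedIsometry ψ ∧ ∀ u y, F (u, y) = (u + w y, ψ y) :=
  ⟨fun hF => ⟨shift ⟨F, hF⟩, baseMap ⟨F, hF⟩, contDiff_shift _, isOrientedIsometry_baseMap _,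
    spi_apply ⟨F, hF⟩⟩, fun ⟨_, _, hw, hψ, h⟩ => isCarrollAut_of_fibred hw hψ h⟩

theorem shift_eq {F : SPI n} {w : Hyp n → ℝ} {ψ : Equiv.Perm (Hyp n)}
    (h : ∀ u y, F.1 (u, y) = (u + w y, ψ y)) : shift F = w := by
  funext y
  rw [shift, h, zero_add]

theorem baseMap_eq {F : SPI n} {w : Hyp n → ℝ} {ψ : Equiv.Perm (Hyp n)}
    (h : ∀ u y, F.1 (u, y) = (u + w y, ψ y)) : baseMap F = ψ := by
  ext1 y
  exact congrArg Prod.snd (h 0 y)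

/-- The automorphism of `Ti` given by a supertranslation and an isometry of `H^n`. -/
def fibredAut (w : Hyp n → ℝ) (ψ : Equiv.Perm (Hyp n)) (hw : ContDiff ℝ ∞ w)
    (hψ : IsOrientedIsometry ψ) : SPI n :=
  ⟨{ toFun := fun p => (p.1 + w p.2, ψ p.2)
     invFun := fun p => (p.1 - w (ψ.symm p.2), ψ.symm p.2)
     left_inv := fun p => by simp
     right_inv := fun p => by simp },
    isCarrollAut_of_fibred hw hψ fun _ _ => rfl⟩

theorem fibredAut_apply (w : Hyp n → ℝ) (ψ : Equiv.Perm (Hyp n)) (hw : ContDiff ℝ ∞ w)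
    (hψ : IsOrientedIsometry ψ) (u : ℝ) (y : Hyp n) :
    (fibredAut w ψ hw hψ).1 (u, y) = (u + w y, ψ y) := rfl

/-! ### Scattering data -/

theorem scatteringData_const_ne_zero {m : ℝ} (hm : 0 < m) :
    ((m ^ ((n : ℝ) / 2 - 1) / (2 * (2 * Real.pi) ^ ((n : ℝ) / 2)) : ℝ) : ℂ) ≠ 0 := by
  have := Real.rpow_pos_of_pos hm ((n : ℝ) / 2 - 1)
  have := Real.rpow_pos_of_pos Real.two_pi_pos ((n : ℝ) / 2)
  exact_mod_cast (by positivity :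
    m ^ ((n : ℝ) / 2 - 1) / (2 * (2 * Real.pi) ^ ((n : ℝ) / 2)) ≠ 0)

/-- The real parameter `m` is left free: it is later taken to be `-m` for an integrating factor and
`m * g y` for differentiation along a supertranslation. -/
theorem hasDerivAt_phase (m : ℝ) (u : ℝ) :
    HasDerivAt (fun s : ℝ => Complex.exp (-(Complex.I * m * s)))
      (-(Complex.I * m) * Complex.exp (-(Complex.I * m * u))) u := by
  have h := ((Complex.ofRealCLM.hasDerivAt (x := u)).const_mul (Complex.I * m)).neg.cexp
  convert! h using 1
  simp
  ring

theorem isEquivariantData_scatteringData (m : ℝ) (a : Hyp n → ℂ) :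
    IsEquivariantData m (scatteringData m a) := by
  intro u y
  convert! (hasDerivAt_phase m u).const_mul
    (((m ^ ((n : ℝ) / 2 - 1) / (2 * (2 * Real.pi) ^ ((n : ℝ) / 2)) : ℝ) : ℂ) * a y) using 1
  simp only [scatteringData]
  ring

theorem IsEquivariantData.apply_eq {m : ℝ} {φ : Ti n → ℂ} (hφ : IsEquivariantData m φ) (u : ℝ)
    (y : Hyp n) : φ (u, y) = φ (0, y) * Complex.exp (-(Complex.I * m * u)) := by
  -- Multiplication by the integrating factor `e^{imu}`.
  have h : ∀ s : ℝ, HasDerivAt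
      (fun s : ℝ => φ (s, y) * Complex.exp (-(Complex.I * (-m : ℝ) * s))) 0 s := by
    intro s
    convert! (hφ s y).mul (hasDerivAt_phase (-m) s) using 1
    push_cast
    ring
  have key := is_const_of_deriv_eq_zero (fun s => (h s).differentiableAt)
    (fun s => (h s).deriv) u 0
  simp only [Complex.ofReal_zero, mul_zero, neg_zero, Complex.exp_zero, mul_one] at key
  rw [← key, mul_assoc, ← Complex.exp_add]
  simp

theorem scatteringData_injective {m : ℝ} (hm : 0 < m) :
    Function.Injective (scatteringData m : (Hyp n → ℂ) → Ti n → ℂ) := by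
  intro a b hab
  funext y
  have h := congrFun hab (0, y)
  simp only [scatteringData, Complex.ofReal_zero, mul_zero, neg_zero, Complex.exp_zero,
    mul_one] at h
  exact mul_left_cancel₀ (scatteringData_const_ne_zero hm) h

theorem isEquivariantData_iff {m : ℝ} (hm : 0 < m) (φ : Ti n → ℂ) :
    IsEquivariantData m φ ↔ ∃! a : Hyp n → ℂ, φ = scatteringData m a := by
  constructor
  · intro hφ
    have hc := scatteringData_const_ne_zero (n := n) hm
    set c := ((m ^ ((n : ℝ) / 2 - 1) / (2 * (2 * Real.pi) ^ ((n : ℝ) / 2)) : ℝ) : ℂ)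
    have h : φ = scatteringData m fun y => c⁻¹ * φ (0, y) := by
      funext ⟨u, y⟩
      rw [hφ.apply_eq]
      change _ = c * (c⁻¹ * _) * _
      rw [mul_inv_cancel_left₀ hc]
    exact ⟨_, h, fun b hb => scatteringData_injective hm (hb.symm.trans h)⟩
  · rintro ⟨a, rfl, -⟩
    exact isEquivariantData_scatteringData m a

theorem pull_scatteringData {m : ℝ} {F : Equiv.Perm (Ti n)} {w : Hyp n → ℝ}
    {ψ : Equiv.Perm (Hyp n)} (h : ∀ u y, F (u, y) = (u + w y, ψ y)) (a : Hyp n → ℂ) :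
    pull F (scatteringData m a) =
      scatteringData m fun y => a (ψ y) * Complex.exp (-(Complex.I * m * w y)) := by
  funext ⟨u, y⟩
  have e : -(Complex.I * m * ((u + w y : ℝ) : ℂ)) =
      -(Complex.I * m * w y) + -(Complex.I * m * u) := by push_cast; ring
  simp only [pull, h, scatteringData, e, Complex.exp_add]
  ring

theorem pull_scatteringData_eq_iff {m : ℝ} (hm : 0 < m) {F : Equiv.Perm (Ti n)} {w : Hyp n → ℝ}
    {ψ : Equiv.Perm (Hyp n)} (h : ∀ u y, F (u, y) = (u + w y, ψ y)) (a a' : Hyp n → ℂ) :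
    pull F (scatteringData m a) = scatteringData m a' ↔
      ∀ y, a' y = a (ψ y) * Complex.exp (-(Complex.I * m * w y)) := by
  rw [pull_scatteringData h, (scatteringData_injective hm).eq_iff, eq_comm, funext_iff]

theorem IsEquivariantData.pull {m : ℝ} {φ : Ti n → ℂ} (hφ : IsEquivariantData m φ)
    {F : Equiv.Perm (Ti n)} {w : Hyp n → ℝ} {ψ : Equiv.Perm (Hyp n)}
    (h : ∀ u y, F (u, y) = (u + w y, ψ y)) : IsEquivariantData m (pull F φ) := by
  intro u y
  have h1 := (hφ (u + w y) (ψ y)).comp_add_const u (w y)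
  simpa only [SpiMassive.pull, h] using h1

/-! ### Lorentz transformations as isometries of `H^n` -/

theorem one_add_norm_sq_pos (y : Hyp n) : 0 < 1 + ‖y‖ ^ 2 := by positivity

theorem momentum_fst_pos (y : Hyp n) : 0 < (momentum y).1 := Real.sqrt_pos.2 (one_add_norm_sq_pos y)

theorem momentum_fst_sq (y : Hyp n) : (momentum y).1 ^ 2 = 1 + ‖y‖ ^ 2 :=
  Real.sq_sqrt (one_add_norm_sq_pos y).le

theorem contDiff_momentum : ContDiff ℝ ∞ (momentum : Hyp n → Mink n) :=
  ((contDiff_const.add (contDiff_norm_sq ℝ)).sqrt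
    fun y => (one_add_norm_sq_pos y).ne').prodMk contDiff_id

/-- The derivative of `momentum`. -/
def momentumDeriv (y : Hyp n) : Hyp n →L[ℝ] Mink n :=
  (((momentum y).1⁻¹ • innerSL ℝ y).prod (ContinuousLinearMap.id ℝ (Hyp n)))

theorem momentumDeriv_apply (y v : Hyp n) :
    momentumDeriv y v = ((momentum y).1⁻¹ * inner ℝ y v, v) := rfl

theorem hasFDerivAt_momentum (y : Hyp n) : HasFDerivAt momentum (momentumDeriv y) y := by
  have h := (((hasFDerivAt_id (𝕜 := ℝ) y).norm_sq).const_add 1).sqrt (one_add_norm_sq_pos y).ne'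
  refine HasFDerivAt.prodMk ?_ (hasFDerivAt_id y)
  convert! h using 1
  ext v
  have := (momentum_fst_pos y).ne'
  simp [momentum] at this ⊢
  field_simp

/-- `h` is the metric induced on the hyperboloid by the Minkowski form. This is what makes Lorentz
transformations isometries. -/
theorem hypMetric_eq_mink (y v w : Hyp n) :
    hypMetric y v w = mink (momentumDeriv y v) (momentumDeriv y w) := by
  have h := momentum_fst_sq y
  have h0 := (momentum_fst_pos y).ne'
  simp only [hypMetric, mink, momentumDeriv_apply, ← h]
  field_simp
  ring

/-- The derivative at `(1, y)` of the cone map `(r, z) ↦ r P(z)`. -/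
def coneFrame (y : Hyp n) : Mink n →ₗ[ℝ] Mink n :=
  (LinearMap.fst ℝ ℝ (Hyp n)).smulRight (momentum y) +
    (momentumDeriv y : Hyp n →ₗ[ℝ] Mink n) ∘ₗ LinearMap.snd ℝ ℝ (Hyp n)

theorem coneFrame_apply (y : Hyp n) (X : Mink n) :
    coneFrame y X = X.1 • momentum y + momentumDeriv y X.2 := rfl

/-- The frame is a shear along `(0, y)` followed by a transvection along `(1, 0)` that scales the
time axis. Its positive determinant transfers orientation from Minkowski space to the hyperboloid.
-/
theorem det_coneFrame (y : Hyp n) : LinearMap.det (coneFrame y) = (momentum y).1⁻¹ := by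
  have h : coneFrame y =
      LinearMap.transvection (((momentum y).1⁻¹ - 1) • LinearMap.fst ℝ ℝ (Hyp n) +
        (((momentum y).1⁻¹ • innerSL ℝ y : Hyp n →L[ℝ] ℝ) : Hyp n →ₗ[ℝ] ℝ) ∘ₗ
          LinearMap.snd ℝ ℝ (Hyp n)) ((1, 0) : ℝ × Hyp n) ∘ₗ
      LinearMap.transvection (LinearMap.fst ℝ ℝ (Hyp n)) ((0, y) : ℝ × Hyp n) := by
    refine LinearMap.ext fun X => ?_
    have h := momentum_fst_sq y
    have h0 := (momentum_fst_pos y).ne'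
    rw [coneFrame_apply, momentumDeriv_apply]
    refine Prod.ext ?_ ?_
    · simp [LinearMap.transvection.apply, inner_add_right, inner_smul_right]
      field_simp
      rw [h]
      ring
    · simp [LinearMap.transvection.apply, momentum, add_comm]
  rw [h, LinearMap.det_comp, LinearMap.transvection.det, LinearMap.transvection.det]
  simp

theorem momentum_lorentz (L : Lorentz n) (y : Hyp n) :
    momentum (L.1 (momentum y)).2 = L.1 (momentum y) :=
  (eq_momentum (by rw [L.2.1, mink_momentum]) (L.2.2.2 y)).symm

/-- The action of a Lorentz transformation on the hyperboloid, in the global chart. -/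
def lorentzPerm (L : Lorentz n) : Equiv.Perm (Hyp n) where
  toFun y := (L.1 (momentum y)).2
  invFun y := (L.1.symm (momentum y)).2
  left_inv y := by
    change (L.1.symm (momentum (L.1 (momentum y)).2)).2 = y
    rw [momentum_lorentz, LinearEquiv.symm_apply_apply]
    rfl
  right_inv y := by
    have h := momentum_lorentz L⁻¹ y
    change momentum (L.1.symm (momentum y)).2 = L.1.symm (momentum y) at h
    change (L.1 (momentum (L.1.symm (momentum y)).2)).2 = y
    rw [h, LinearEquiv.apply_symm_apply]
    rfl

theorem lorentzPerm_apply (L : Lorentz n) (y : Hyp n) :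
    lorentzPerm L y = (L.1 (momentum y)).2 := rfl

theorem momentum_lorentzPerm (L : Lorentz n) (y : Hyp n) :
    momentum (lorentzPerm L y) = L.1 (momentum y) := momentum_lorentz L y

theorem contDiff_lorentzPerm (L : Lorentz n) : ContDiff ℝ ∞ (lorentzPerm L) :=
  contDiff_snd.comp ((LinearMap.toContinuousLinearMap (L.1 : Mink n →ₗ[ℝ] Mink n)).contDiff.comp
    contDiff_momentum)

/-- Both sides are derivatives of the same map, since `momentum ∘ lorentzPerm L = L ∘ momentum`. -/
theorem momentumDeriv_lorentzPerm (L : Lorentz n) (y v : Hyp n) :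
    momentumDeriv (lorentzPerm L y) (fderiv ℝ (lorentzPerm L) y v) =
      L.1 (momentumDeriv y v) := by
  have h1 := (hasFDerivAt_momentum (lorentzPerm L y)).comp y
    ((contDiff_lorentzPerm L).differentiable (by simp) y).hasFDerivAt
  have h2 := ((LinearMap.toContinuousLinearMap (L.1 : Mink n →ₗ[ℝ] Mink n)).hasFDerivAt
    (x := momentum y)).comp y (hasFDerivAt_momentum y)
  have h3 : momentum ∘ lorentzPerm L =
      LinearMap.toContinuousLinearMap (L.1 : Mink n →ₗ[ℝ] Mink n) ∘ momentum :=
    funext (momentum_lorentzPerm L)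
  rw [h3] at h1
  exact congrArg (fun A : Hyp n →L[ℝ] Mink n => A v) (h1.unique h2)

theorem isOrientedIsometry_lorentzPerm (L : Lorentz n) : IsOrientedIsometry (lorentzPerm L) := by
  refine ⟨contDiff_lorentzPerm L, contDiff_lorentzPerm L⁻¹, ?_, ?_⟩
  · intro y v w
    rw [hypMetric_eq_mink, hypMetric_eq_mink, momentumDeriv_lorentzPerm,
      momentumDeriv_lorentzPerm, L.2.1]
  · intro y
    -- `L` is linear, so on the cone it fixes the radial parameter and acts on the hyperboloid by
    -- `lorentzPerm L`. Determinants of this identity express `det L = 1` through the derivative on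
    -- `H^n` and two positive factors.
    have h : (L.1 : Mink n →ₗ[ℝ] Mink n) ∘ₗ coneFrame y = coneFrame (lorentzPerm L y) ∘ₗ
        LinearMap.prodMap LinearMap.id (fderiv ℝ (lorentzPerm L) y : Hyp n →ₗ[ℝ] Hyp n) := by
      refine LinearMap.ext fun X => ?_
      change L.1 (coneFrame y X) = coneFrame (lorentzPerm L y) (X.1, fderiv ℝ (lorentzPerm L) y X.2)
      rw [coneFrame_apply, coneFrame_apply, momentumDeriv_lorentzPerm, momentum_lorentzPerm,
        map_add, map_smul]
    have h' := congrArg LinearMap.det h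
    rw [LinearMap.det_comp, LinearMap.det_comp, LinearMap.det_prodMap, LinearMap.det_id,
      det_coneFrame, det_coneFrame, L.2.2.1, one_mul, one_mul] at h'
    exact pos_of_mul_pos_right (h' ▸ inv_pos.2 (momentum_fst_pos y))
      (inv_pos.2 (momentum_fst_pos _)).le

/-! ### Transvections of `H^n` -/

theorem mink_comm (X Y : Mink n) : mink X Y = mink Y X := by
  simp only [mink, real_inner_comm, mul_comm]

/-- The Minkowski form as a linear form in the first variable. -/
def minkLin (Y : Mink n) : Mink n →ₗ[ℝ] ℝ where
  toFun X := mink X Y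
  map_add' X X' := by simp [mink, inner_add_left]; ring
  map_smul' c X := by simp [mink, inner_smul_left]; ring

theorem minkLin_apply (X Y : Mink n) : minkLin Y X = mink X Y := rfl

theorem mink_add_left (X X' Y : Mink n) : mink (X + X') Y = mink X Y + mink X' Y :=
  map_add (minkLin Y) X X'

theorem mink_smul_left (c : ℝ) (X Y : Mink n) : mink (c • X) Y = c * mink X Y :=
  map_smul (minkLin Y) c X

theorem mink_sub_left (X X' Y : Mink n) : mink (X - X') Y = mink X Y - mink X' Y :=
  map_sub (minkLin Y) X X'

theorem mink_add_right (X Y Y' : Mink n) : mink X (Y + Y') = mink X Y + mink X Y' := by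
  simp only [mink_comm X, mink_add_left]

theorem mink_smul_right (c : ℝ) (X Y : Mink n) : mink X (c • Y) = c * mink X Y := by
  simp only [mink_comm X, mink_smul_left]

theorem mink_sub_right (X Y Y' : Mink n) : mink X (Y - Y') = mink X Y - mink X Y' := by
  simp only [mink_comm X, mink_sub_left]

/-- The reflection of Minkowski space in the hyperplane orthogonal to `P(p)`. -/
def timeReflection (p : Hyp n) : Mink n ≃ₗ[ℝ] Mink n :=
  LinearEquiv.ofInvolutive (LinearMap.transvection (minkLin (momentum p)) ((2 : ℝ) • momentum p))
    fun X => by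
      simp only [LinearMap.transvection.apply, minkLin_apply, mink_add_left, mink_smul_left,
        mink_momentum]
      module

theorem timeReflection_apply (p : Hyp n) (X : Mink n) :
    timeReflection p X = X + (2 * mink X (momentum p)) • momentum p := by
  change LinearMap.transvection (minkLin (momentum p)) ((2 : ℝ) • momentum p) X = _
  rw [LinearMap.transvection.apply, smul_smul, minkLin_apply, mul_comm]

theorem det_timeReflection (p : Hyp n) :
    LinearMap.det (timeReflection p : Mink n →ₗ[ℝ] Mink n) = -1 := by
  change LinearMap.det (LinearMap.transvection (minkLin (momentum p)) ((2 : ℝ) • momentum p)) = _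
  rw [LinearMap.transvection.det, minkLin_apply, mink_smul_left, mink_momentum]
  norm_num

theorem mink_timeReflection (p : Hyp n) (X Y : Mink n) :
    mink (timeReflection p X) (timeReflection p Y) = mink X Y := by
  simp only [timeReflection_apply, mink_add_left, mink_add_right, mink_smul_left,
    mink_smul_right, mink_momentum, mink_comm (momentum p)]
  ring

theorem timeReflection_zero_momentum (y : Hyp n) :
    timeReflection 0 (momentum y) = -momentum (-y) := by
  rw [timeReflection_apply]
  refine Prod.ext ?_ ?_
  · simp [mink, momentum]; ring
  · simp [momentum]

/-- The reflection interchanges the two sheets. With `c`, `d` the time components of `P(p)`, `P(z)`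
and `t = ⟨z, p⟩`, the claim is `2ct < d(2c² - 1)`. Cauchy–Schwarz bounds `t²` by `(d² - 1)(c² - 1)`,
and the squares then differ by at least `d² + 4c²(c² - 1) > 0`. -/
theorem timeReflection_neg_momentum_fst_pos (p z : Hyp n) :
    0 < (timeReflection p (-momentum z)).1 := by
  have hc := momentum_fst_sq p
  have hc0 := momentum_fst_pos p
  have hz := momentum_fst_sq z
  have hz0 := momentum_fst_pos z
  have ht := abs_real_inner_le_norm z p
  have e : (timeReflection p (-momentum z)).1 = -(momentum z).1 +
      2 * ((momentum z).1 * (momentum p).1 - inner ℝ z p) * (momentum p).1 := by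
    rw [timeReflection_apply]
    have : mink (-momentum z) (momentum p) = (momentum z).1 * (momentum p).1 - inner ℝ z p := by
      simp [mink, momentum, inner_neg_left]
      ring
    rw [this]
    rfl
  rw [e]
  set c := (momentum p).1
  set d := (momentum z).1
  set t : ℝ := inner ℝ z p
  have ht2 : t ^ 2 ≤ (d ^ 2 - 1) * (c ^ 2 - 1) := by
    have h1 : t ^ 2 ≤ (‖z‖ * ‖p‖) ^ 2 := by
      rw [← sq_abs t]
      exact pow_le_pow_left₀ (abs_nonneg _) ht 2
    rw [hc, hz]
    linarith [mul_pow ‖z‖ ‖p‖ 2]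
  have hc1 : 1 ≤ c ^ 2 := by rw [hc]; nlinarith [sq_nonneg ‖p‖]
  have h1 : (2 * c * t) ^ 2 < (d * (2 * c ^ 2 - 1)) ^ 2 := by
    have : (2 * c * t) ^ 2 ≤ 4 * c ^ 2 * ((d ^ 2 - 1) * (c ^ 2 - 1)) := by
      have := mul_le_mul_of_nonneg_left ht2 (by positivity : 0 ≤ 4 * c ^ 2)
      linarith [mul_pow (2 * c) t 2, mul_pow 2 c 2]
    have h2 : 0 ≤ 4 * c ^ 2 * (c ^ 2 - 1) := by
      have := sub_nonneg.2 hc1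
      positivity
    have h3 : 0 < d ^ 2 := by positivity
    linarith [show (d * (2 * c ^ 2 - 1)) ^ 2 =
      4 * c ^ 2 * ((d ^ 2 - 1) * (c ^ 2 - 1)) + (d ^ 2 + 4 * c ^ 2 * (c ^ 2 - 1)) by ring]
  have h3 : 0 ≤ d * (2 * c ^ 2 - 1) := mul_nonneg hz0.le (by linarith)
  have h4 : 2 * c * t < d * (2 * c ^ 2 - 1) := by
    have := sq_lt_sq.1 h1
    rw [abs_of_nonneg h3] at this
    exact (le_abs_self _).trans_lt this
  linarith

/-- The product of the point reflections at `0` and at `p`, as a Lorentz transformation. -/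
def lorentzTransvection (p : Hyp n) : Lorentz n :=
  ⟨(timeReflection 0).trans (timeReflection p), fun X Y => by
    rw [LinearEquiv.trans_apply, LinearEquiv.trans_apply, mink_timeReflection,
      mink_timeReflection], by
    rw [LinearEquiv.coe_trans, LinearMap.det_comp, det_timeReflection, det_timeReflection]
    norm_num, fun y => by
    rw [LinearEquiv.trans_apply, timeReflection_zero_momentum]
    exact timeReflection_neg_momentum_fst_pos p (-y)⟩

theorem lorentzTransvection_momentum (p y : Hyp n) :
    (lorentzTransvection p).1 (momentum y) =
      -momentum (-y) - (2 * mink (momentum (-y)) (momentum p)) • momentum p := by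
  change timeReflection p (timeReflection 0 (momentum y)) = _
  rw [timeReflection_zero_momentum, map_neg, timeReflection_apply]
  module

/-- Joint continuity in `(p, y)` and differentiability in `p` are read off from this formula. -/
theorem lorentzPerm_transvection (p y : Hyp n) : lorentzPerm (lorentzTransvection p) y =
    y - (2 * mink (momentum (-y)) (momentum p)) • p := by
  rw [lorentzPerm_apply, lorentzTransvection_momentum]
  simp [momentum]

/-- The point reflection at `0` sends `y` to `-y`, and the one at the hyperbolic midpoint of `-y`
and `z` sends `-y` to `z`. The midpoint is the normalised sum of the two unit vectors. -/
theorem exists_lorentzPerm_transvection_eq (y z : Hyp n) :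
    ∃ p, lorentzPerm (lorentzTransvection p) y = z := by
  set S : Mink n := momentum (-y) + momentum z with hS
  set t := mink (momentum (-y)) (momentum z) with ht
  have hSS : mink S S = 2 * t - 2 := by
    simp only [hS, mink_add_left, mink_add_right, mink_momentum,
      mink_comm (momentum z) (momentum (-y)), ← ht]
    ring
  -- Enough to normalise `S`; Cauchy–Schwarz even gives `t ≤ 0`.
  have ht0 : t < 1 := by
    have h1 := (abs_le.1 (abs_real_inner_le_norm (-y) z)).2
    have h2 : ‖-y‖ ≤ (momentum (-y)).1 := Real.le_sqrt_of_sq_le (by linarith)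
    have h3 : ‖z‖ ≤ (momentum z).1 := Real.le_sqrt_of_sq_le (by linarith)
    have h4 : ‖-y‖ * ‖z‖ ≤ (momentum (-y)).1 * (momentum z).1 :=
      mul_le_mul h2 h3 (norm_nonneg _) (momentum_fst_pos _).le
    have h5 : t = -((momentum (-y)).1 * (momentum z).1) + inner ℝ (-y) z := rfl
    linarith
  have hN : 0 < Real.sqrt (2 - 2 * t) := Real.sqrt_pos.2 (by linarith)
  have hN2 : Real.sqrt (2 - 2 * t) ^ 2 = 2 - 2 * t := Real.sq_sqrt (by linarith)
  set N := Real.sqrt (2 - 2 * t)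
  have hp : N⁻¹ • S = momentum (N⁻¹ • S).2 := by
    apply eq_momentum
    · rw [mink_smul_left, mink_smul_right, hSS]
      field_simp
      linarith
    · exact mul_pos (inv_pos.2 hN) (add_pos (momentum_fst_pos _) (momentum_fst_pos _))
  refine ⟨(N⁻¹ • S).2, ?_⟩
  have h2 : 2 * mink (momentum (-y)) (N⁻¹ • S) = -N := by
    rw [mink_smul_right, hS, mink_add_right, mink_momentum, ← ht]
    field_simp
    linarith
  rw [lorentzPerm_apply, lorentzTransvection_momentum, ← hp, h2, smul_smul, neg_mul,
    mul_inv_cancel₀ hN.ne', hS]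
  simp [momentum]

/-! ### Invariance of the measure -/

/-- The endomorphism representing the hyperbolic metric at `y` in the Euclidean inner product. -/
def hypGram (y : Hyp n) : Hyp n →ₗ[ℝ] Hyp n :=
  LinearMap.transvection (innerSL ℝ y : Hyp n →ₗ[ℝ] ℝ) (-(1 + ‖y‖ ^ 2)⁻¹ • y)

theorem hypMetric_eq_inner (y v w : Hyp n) : hypMetric y v w = inner ℝ v (hypGram y w) := by
  simp only [hypMetric, hypGram, LinearMap.transvection.apply, inner_add_right, inner_smul_right,
    real_inner_comm y v, ContinuousLinearMap.coe_coe, innerSL_apply_apply]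
  ring

theorem det_hypGram (y : Hyp n) : LinearMap.det (hypGram y) = (1 + ‖y‖ ^ 2)⁻¹ := by
  have h := (one_add_norm_sq_pos y).ne'
  rw [hypGram, LinearMap.transvection.det, map_smul, ContinuousLinearMap.coe_coe,
    innerSL_apply_apply, real_inner_self_eq_norm_sq, smul_eq_mul]
  field_simp
  ring

theorem det_adjoint_real (A : Hyp n →ₗ[ℝ] Hyp n) :
    LinearMap.det (LinearMap.adjoint A) = LinearMap.det A := by
  let b := EuclideanSpace.basisFun (Fin n) ℝ
  rw [← LinearMap.det_toMatrix b.toBasis, ← LinearMap.det_toMatrix b.toBasis,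
    LinearMap.toMatrix_adjoint, Matrix.det_conjTranspose, star_trivial]

/-- Being an isometry reads `Dᵀ G(ψ y) D = G(y)` for the Gram operators, so `(det D)²` is a quotient
of their determinants; orientation selects the positive root. -/
theorem IsOrientedIsometry.det_eq {ψ : Equiv.Perm (Hyp n)} (hψ : IsOrientedIsometry ψ)
    (y : Hyp n) :
    (fderiv ℝ ψ y).det = Real.sqrt (1 + ‖ψ y‖ ^ 2) / Real.sqrt (1 + ‖y‖ ^ 2) := by
  set D : Hyp n →ₗ[ℝ] Hyp n := (fderiv ℝ ψ y : Hyp n →ₗ[ℝ] Hyp n)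
  have h : LinearMap.adjoint D ∘ₗ hypGram (ψ y) ∘ₗ D = hypGram y := by
    refine LinearMap.ext fun w => ext_inner_left ℝ fun v => ?_
    rw [← hypMetric_eq_inner, LinearMap.comp_apply, LinearMap.adjoint_inner_right,
      LinearMap.comp_apply, ← hypMetric_eq_inner]
    exact hψ.metric y v w
  have h' := congrArg LinearMap.det h
  rw [LinearMap.det_comp, LinearMap.det_comp, det_adjoint_real, det_hypGram, det_hypGram] at h'
  have hd : LinearMap.det D = (fderiv ℝ ψ y).det := rfl
  rw [hd] at h'
  have hpos := hψ.orient y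
  have h1 := one_add_norm_sq_pos y
  have h2 := one_add_norm_sq_pos (ψ y)
  rw [← Real.sqrt_div h2.le, ← Real.sqrt_sq hpos.le]
  congr 1
  field_simp at h' ⊢
  linarith

/-- The density of `massMeasure` with respect to Lebesgue measure. -/
def massDensity (m : ℝ) (k : Hyp n) : ℝ :=
  m ^ ((n : ℝ) - 1) / (2 * (2 * Real.pi) ^ n) / Real.sqrt (1 + ‖k‖ ^ 2)

theorem massDensity_pos {m : ℝ} (hm : 0 < m) (k : Hyp n) : 0 < massDensity m k := by
  have := Real.rpow_pos_of_pos hm ((n : ℝ) - 1)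
  have := Real.pi_pos
  have := one_add_norm_sq_pos k
  unfold massDensity
  positivity

theorem continuous_massDensity (m : ℝ) : Continuous (massDensity m : Hyp n → ℝ) := by
  unfold massDensity
  refine continuous_const.div (by fun_prop) fun k => ?_
  exact (momentum_fst_pos k).ne'

theorem massMeasure_eq (m : ℝ) : massMeasure m n =
    MeasureTheory.volume.withDensity fun k => ENNReal.ofReal (massDensity m k) := rfl

theorem measurable_ofReal_massDensity (m : ℝ) :
    Measurable fun k : Hyp n => ENNReal.ofReal (massDensity m k) :=
  (continuous_massDensity m).measurable.ennreal_ofReal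

/-- The density is positive everywhere. Null-set arguments can therefore be carried out for Lebesgue
measure. -/
theorem ae_massMeasure_iff {m : ℝ} (hm : 0 < m) {p : Hyp n → Prop} :
    (∀ᵐ y ∂massMeasure m n, p y) ↔ ∀ᵐ y : Hyp n, p y := by
  constructor
  · exact fun h => (MeasureTheory.withDensity_absolutelyContinuous'
      (measurable_ofReal_massDensity m).aemeasurable
      (Filter.Eventually.of_forall fun k =>
        (ENNReal.ofReal_pos.2 (massDensity_pos hm k)).ne')).ae_le h
  · exact fun h => (MeasureTheory.withDensity_absolutelyContinuous _ _).ae_le h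

/-- In the change of variables formula the Jacobian cancels the quotient of the densities at `ψ k`
and `k`. -/
theorem IsOrientedIsometry.measurePreserving {m : ℝ} (hm : 0 < m) {ψ : Equiv.Perm (Hyp n)}
    (hψ : IsOrientedIsometry ψ) :
    MeasureTheory.MeasurePreserving ψ (massMeasure m n) (massMeasure m n) := by
  have hmeas : Measurable ψ := hψ.smooth.continuous.measurable
  refine ⟨hmeas, MeasureTheory.Measure.ext fun s hs => ?_⟩
  rw [MeasureTheory.Measure.map_apply hmeas hs, massMeasure_eq,
    MeasureTheory.withDensity_apply _ hs, MeasureTheory.withDensity_apply _ (hmeas hs)]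
  have h := MeasureTheory.lintegral_image_eq_lintegral_abs_det_fderiv_mul MeasureTheory.volume
    (hmeas hs) (f := ψ) (f' := fderiv ℝ ψ)
    (fun x _ => ((hψ.smooth.differentiable (by simp) x).hasFDerivAt).hasFDerivWithinAt)
    ψ.injective.injOn fun k => ENNReal.ofReal (massDensity m k)
  rw [Set.image_preimage_eq _ ψ.surjective] at h
  rw [h]
  congr 1
  funext k
  rw [← ENNReal.ofReal_mul (abs_nonneg _), abs_of_pos (hψ.orient k), hψ.det_eq]
  congr 1
  have h1 := (momentum_fst_pos (ψ k)).ne'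
  simp only [massDensity]
  simp only [momentum] at h1
  field_simp

theorem integral_massMeasure {m : ℝ} (hm : 0 < m) (f : Hyp n → ℝ) :
    ∫ k, f k ∂massMeasure m n = m ^ ((n : ℝ) - 1) / (2 * (2 * Real.pi) ^ n) *
      ∫ k : Hyp n, f k / Real.sqrt (1 + ‖k‖ ^ 2) := by
  rw [massMeasure_eq, integral_withDensity_eq_integral_toReal_smul
    (measurable_ofReal_massDensity m) (Filter.Eventually.of_forall fun _ => ENNReal.ofReal_lt_top),
    ← MeasureTheory.integral_const_mul]
  congr 1
  funext k
  rw [ENNReal.toReal_ofReal (massDensity_pos hm k).le, massDensity, smul_eq_mul]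
  ring

theorem norm_sq_massiveL2 {m : ℝ} (hm : 0 < m) (a : MassiveL2 m n) : ‖a‖ ^ 2 =
    m ^ ((n : ℝ) - 1) / (2 * (2 * Real.pi) ^ n) *
      ∫ k : Hyp n, ‖a k‖ ^ 2 / Real.sqrt (1 + ‖k‖ ^ 2) := by
  have h : ‖a‖ ^ 2 = ∫ k, ‖a k‖ ^ 2 ∂massMeasure m n := by
    have h1 := MeasureTheory.L2.inner_def (𝕜 := ℂ) a a
    rw [inner_self_eq_norm_sq_to_K] at h1
    simp only [inner_self_eq_norm_sq_to_K] at h1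
    have h2 : ((‖a‖ ^ 2 : ℝ) : ℂ) = ((∫ k, ‖a k‖ ^ 2 ∂massMeasure m n : ℝ) : ℂ) := by
      rw [← integral_complex_ofReal]
      push_cast
      exact h1
    exact_mod_cast h2
  rw [h, integral_massMeasure hm]

/-! ### The unitary representation -/

theorem measurePreserving_baseMap {m : ℝ} (hm : 0 < m) (F : SPI n) :
    MeasureTheory.MeasurePreserving (baseMap F) (massMeasure m n) (massMeasure m n) :=
  (isOrientedIsometry_baseMap F).measurePreserving hm

/-- The phase `e^{-i m ω}` of the supertranslation part of an automorphism of `Ti`. -/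
def shiftPhase (m : ℝ) (F : SPI n) (y : Hyp n) : ℂ :=
  Complex.exp (-(Complex.I * m * shift F y))

theorem norm_shiftPhase (m : ℝ) (F : SPI n) (y : Hyp n) : ‖shiftPhase m F y‖ = 1 := by
  have e : -(Complex.I * m * shift F y) = ((-(m * shift F y) : ℝ) : ℂ) * Complex.I := by
    push_cast; ring
  rw [shiftPhase, e, Complex.norm_exp_ofReal_mul_I]

theorem continuous_shiftPhase (m : ℝ) (F : SPI n) : Continuous (shiftPhase m F) := by
  have := (contDiff_shift F).continuous
  unfold shiftPhase
  fun_prop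

theorem spi_mul_apply (F G : SPI n) (y : Hyp n) : (F * G).1 (0, y) =
    (shift G y + shift F (baseMap G y), baseMap F (baseMap G y)) :=
  spi_apply F (shift G y) (baseMap G y)

/-- The cocycle identity behind `pullL2_mul`. Pullback reverses products, which is why `massiveRep`
uses `F⁻¹`. -/
theorem shiftPhase_mul (m : ℝ) (F G : SPI n) (y : Hyp n) :
    shiftPhase m (F * G) y = shiftPhase m F (baseMap G y) * shiftPhase m G y := by
  have h : shift (F * G) y = shift G y + shift F (baseMap G y) :=
    congrArg Prod.fst (spi_mul_apply F G y)
  rw [shiftPhase, shiftPhase, shiftPhase, h, ← Complex.exp_add]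
  push_cast
  congr 1
  ring

theorem baseMap_mul (F G : SPI n) (y : Hyp n) : baseMap (F * G) y = baseMap F (baseMap G y) := by
  have h := congrArg Prod.snd (spi_mul_apply F G y)
  exact h

theorem memLp_pull {m : ℝ} (hm : 0 < m) (F : SPI n) (a : MassiveL2 m n) :
    MeasureTheory.MemLp (fun y => a (baseMap F y) * shiftPhase m F y) 2 (massMeasure m n) := by
  have h := (MeasureTheory.Lp.memLp a).comp_measurePreserving (measurePreserving_baseMap hm F)
  refine h.of_le (h.1.mul (continuous_shiftPhase m F).aestronglyMeasurable)
    (Filter.Eventually.of_forall fun y => ?_)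
  rw [norm_mul, norm_shiftPhase, mul_one]
  rfl

/-- The action of an automorphism of `Ti` on Fourier coefficients, by pullback. -/
def pullL2 {m : ℝ} (hm : 0 < m) (F : SPI n) (a : MassiveL2 m n) : MassiveL2 m n :=
  (memLp_pull hm F a).toLp

theorem coeFn_pullL2 {m : ℝ} (hm : 0 < m) (F : SPI n) (a : MassiveL2 m n) :
    pullL2 hm F a =ᵐ[massMeasure m n] fun y => a (baseMap F y) * shiftPhase m F y :=
  (memLp_pull hm F a).coeFn_toLp

theorem pullL2_add {m : ℝ} (hm : 0 < m) (F : SPI n) (a b : MassiveL2 m n) :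
    pullL2 hm F (a + b) = pullL2 hm F a + pullL2 hm F b := by
  refine MeasureTheory.Lp.ext ?_
  filter_upwards [coeFn_pullL2 hm F (a + b), coeFn_pullL2 hm F a, coeFn_pullL2 hm F b,
    MeasureTheory.Lp.coeFn_add (pullL2 hm F a) (pullL2 hm F b),
    (measurePreserving_baseMap hm F).quasiMeasurePreserving.ae
      (MeasureTheory.Lp.coeFn_add a b)] with y h1 h2 h3 h4 h5
  rw [h1, h4, Pi.add_apply, h2, h3, h5, Pi.add_apply, add_mul]

theorem pullL2_smul {m : ℝ} (hm : 0 < m) (F : SPI n) (c : ℂ) (a : MassiveL2 m n) :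
    pullL2 hm F (c • a) = c • pullL2 hm F a := by
  refine MeasureTheory.Lp.ext ?_
  filter_upwards [coeFn_pullL2 hm F (c • a), coeFn_pullL2 hm F a,
    MeasureTheory.Lp.coeFn_smul c (pullL2 hm F a),
    (measurePreserving_baseMap hm F).quasiMeasurePreserving.ae
      (MeasureTheory.Lp.coeFn_smul c a)] with y h1 h2 h3 h4
  rw [h1, h3, Pi.smul_apply, h2, h4, Pi.smul_apply, smul_mul_assoc]

theorem norm_pullL2 {m : ℝ} (hm : 0 < m) (F : SPI n) (a : MassiveL2 m n) :
    ‖pullL2 hm F a‖ = ‖a‖ := by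
  rw [← MeasureTheory.Lp.norm_compMeasurePreserving a (measurePreserving_baseMap hm F)]
  refine le_antisymm ?_ ?_ <;> refine MeasureTheory.Lp.norm_le_norm_of_ae_le ?_ <;>
  filter_upwards [coeFn_pullL2 hm F a, MeasureTheory.Lp.coeFn_compMeasurePreserving a
    (measurePreserving_baseMap hm F)] with y h1 h2 <;>
  rw [h1, h2, norm_mul, norm_shiftPhase, mul_one] <;> rfl

theorem pullL2_mul {m : ℝ} (hm : 0 < m) (F G : SPI n) (a : MassiveL2 m n) :
    pullL2 hm (F * G) a = pullL2 hm G (pullL2 hm F a) := by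
  refine MeasureTheory.Lp.ext ?_
  filter_upwards [coeFn_pullL2 hm (F * G) a, coeFn_pullL2 hm G (pullL2 hm F a),
    (measurePreserving_baseMap hm G).quasiMeasurePreserving.ae (coeFn_pullL2 hm F a)]
    with y h1 h2 h3
  rw [h1, h2, h3, shiftPhase_mul, baseMap_mul, mul_assoc]

theorem pullL2_one {m : ℝ} (hm : 0 < m) (a : MassiveL2 m n) : pullL2 hm (1 : SPI n) a = a := by
  refine MeasureTheory.Lp.ext ?_
  filter_upwards [coeFn_pullL2 hm (1 : SPI n) a] with y h1
  rw [h1, shiftPhase]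
  have h2 : baseMap (1 : SPI n) y = y := rfl
  have h3 : shift (1 : SPI n) y = 0 := rfl
  simp [h2, h3]

/-- The unitary representation of the SPI group on the one-particle Hilbert space. -/
def massiveRep {m : ℝ} (hm : 0 < m) : SPI n →* (MassiveL2 m n ≃ₗᵢ[ℂ] MassiveL2 m n) where
  toFun F :=
    { toFun := pullL2 hm F⁻¹
      invFun := pullL2 hm F
      map_add' := pullL2_add hm F⁻¹
      map_smul' := pullL2_smul hm F⁻¹
      left_inv := fun a => by rw [← pullL2_mul, inv_mul_cancel, pullL2_one]
      right_inv := fun a => by rw [← pullL2_mul, mul_inv_cancel, pullL2_one]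
      norm_map' := norm_pullL2 hm F⁻¹ }
  map_one' := LinearIsometryEquiv.ext fun a => by
    change pullL2 hm 1⁻¹ a = a
    rw [inv_one, pullL2_one]
  map_mul' F G := LinearIsometryEquiv.ext fun a => by
    change pullL2 hm (F * G)⁻¹ a = pullL2 hm F⁻¹ (pullL2 hm G⁻¹ a)
    rw [mul_inv_rev, pullL2_mul]

theorem massiveRep_apply {m : ℝ} (hm : 0 < m) (F : SPI n) (a : MassiveL2 m n) :
    massiveRep hm F a = pullL2 hm F⁻¹ a := rfl

theorem massiveRep_inv_ae_eq {m : ℝ} (hm : 0 < m) {F : SPI n} {w : Hyp n → ℝ}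
    {ψ : Equiv.Perm (Hyp n)} (h : ∀ u y, F.1 (u, y) = (u + w y, ψ y)) (a : MassiveL2 m n) :
    massiveRep hm F⁻¹ a =ᵐ[massMeasure m n]
      fun y => a (ψ y) * Complex.exp (-(Complex.I * m * w y)) := by
  rw [massiveRep_apply, inv_inv]
  filter_upwards [coeFn_pullL2 hm F a] with y hy
  rw [hy, shiftPhase, shift_eq h, baseMap_eq h]

/-! ### Irreducibility -/

/-- An integrable function orthogonal to all phases `e^{-i m g}` with `g` smooth vanishes. -/
theorem ae_eq_zero_of_forall_integral_phase {m : ℝ} (hm : 0 < m) {μ : MeasureTheory.Measure (Hyp n)}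
    {f : Hyp n → ℂ} (hf : MeasureTheory.Integrable f μ)
    (h : ∀ g : Hyp n → ℝ, ContDiff ℝ ∞ g →
      ∫ y, f y * Complex.exp (-(Complex.I * m * g y)) ∂μ = 0) :
    ∀ᵐ y ∂μ, f y = 0 := by
  refine ae_eq_zero_of_integral_contDiff_smul_eq_zero hf.locallyIntegrable fun g hg hgc => ?_
  obtain ⟨C, hC⟩ := hgc.exists_bound_of_continuous hg.continuous
  have hC0 : 0 ≤ C := (norm_nonneg _).trans (hC 0)
  have hgm := hg.continuous
  have hexp : ∀ (t : ℝ) (y : Hyp n), ‖Complex.exp (-(Complex.I * (m * g y : ℝ) * t))‖ = 1 := by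
    intro t y
    have e : -(Complex.I * (m * g y : ℝ) * t) = ((-(m * g y * t) : ℝ) : ℂ) * Complex.I := by
      push_cast; ring
    rw [e, Complex.norm_exp_ofReal_mul_I]
  -- The integral is differentiated at `t = 0` along the supertranslations `t g`, with `g` a
  -- compactly supported test function; its bound `C` supplies the dominating function `‖f‖ m C`.
  -- The integral vanishes for every `t`, so its derivative `-im ∫ g f` is zero.
  have key := (hasDerivAt_integral_of_dominated_loc_of_deriv_le (𝕜 := ℝ) (μ := μ) (x₀ := 0)
    (F := fun t y => f y * Complex.exp (-(Complex.I * (m * g y : ℝ) * (t : ℂ))))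
    (F' := fun t y => f y * (-(Complex.I * (m * g y : ℝ)) *
      Complex.exp (-(Complex.I * (m * g y : ℝ) * (t : ℂ)))))
    (bound := fun y => ‖f y‖ * (m * C)) (s := Set.univ) Filter.univ_mem
    (Filter.Eventually.of_forall fun t => hf.1.mul
      (Continuous.aestronglyMeasurable (by fun_prop)))
    (by simpa using hf)
    (hf.1.mul (Continuous.aestronglyMeasurable (by fun_prop)))
    (Filter.Eventually.of_forall fun y t _ => by
      rw [norm_mul, norm_mul, hexp, mul_one, norm_neg, norm_mul, Complex.norm_I, one_mul,
        Complex.norm_real, norm_mul, Real.norm_of_nonneg hm.le]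
      exact mul_le_mul_of_nonneg_left (mul_le_mul_of_nonneg_left (hC y) hm.le) (norm_nonneg _))
    (hf.norm.mul_const _)
    (Filter.Eventually.of_forall fun y t _ => (hasDerivAt_phase (m * g y) t).const_mul (f y))).2
  have h0 : (fun t : ℝ => ∫ y, f y * Complex.exp (-(Complex.I * (m * g y : ℝ) * (t : ℂ))) ∂μ) =
      fun _ => 0 := by
    funext t
    rw [← h (fun y => t * g y) (contDiff_const.mul hg)]
    congr 1
    funext y
    congr 2
    push_cast
    ring
  rw [h0] at key
  have h1 := key.unique (hasDerivAt_const (0 : ℝ) (0 : ℂ))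
  have h2 : ∀ y, f y * (-(Complex.I * (m * g y : ℝ)) *
      Complex.exp (-(Complex.I * (m * g y : ℝ) * ((0 : ℝ) : ℂ)))) =
      -(Complex.I * m) * (g y • f y) := by
    intro y
    simp only [Complex.ofReal_zero, mul_zero, neg_zero, Complex.exp_zero, Complex.real_smul]
    push_cast
    ring
  simp only [h2] at h1
  rw [MeasureTheory.integral_const_mul] at h1
  refine (mul_eq_zero.1 h1).resolve_left ?_
  exact neg_ne_zero.2 (mul_ne_zero Complex.I_ne_zero (Complex.ofReal_ne_zero.2 hm.ne'))

theorem continuous_lorentzPerm_transvection :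
    Continuous fun q : Hyp n × Hyp n => lorentzPerm (lorentzTransvection q.1) q.2 := by
  simp only [lorentzPerm_transvection, mink, momentum]
  fun_prop

theorem differentiable_lorentzPerm_transvection (y : Hyp n) :
    Differentiable ℝ fun p : Hyp n => lorentzPerm (lorentzTransvection p) y := by
  have h1 : Differentiable ℝ (momentum : Hyp n → Mink n) :=
    contDiff_momentum.differentiable (by simp)
  have h2 : Differentiable ℝ fun p : Hyp n => mink (momentum (-y)) (momentum p) := by
    have : (fun p : Hyp n => mink (momentum (-y)) (momentum p)) =
        fun p => LinearMap.toContinuousLinearMap (minkLin (momentum (-y))) (momentum p) :=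
      funext fun p => mink_comm _ _
    rw [this]
    exact (ContinuousLinearMap.differentiable _).comp h1
  simp only [lorentzPerm_transvection]
  exact (differentiable_const y).sub ((h2.const_mul 2).smul differentiable_id)

/-- Two functions separated by all transvections of `H^n`: one of them vanishes. -/
theorem ae_eq_zero_or_ae_eq_zero_of_transvections {a b : Hyp n → ℂ} (ha : Measurable a)
    (hb : Measurable b)
    (h : ∀ p, ∀ᵐ y : Hyp n, b y = 0 ∨ a (lorentzPerm (lorentzTransvection p) y) = 0) :
    (∀ᵐ y : Hyp n, b y = 0) ∨ ∀ᵐ y : Hyp n, a y = 0 := by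
  rw [or_iff_not_imp_left]
  intro hb0
  have hmeas : MeasurableSet {q : Hyp n × Hyp n |
      b q.2 = 0 ∨ a (lorentzPerm (lorentzTransvection q.1) q.2) = 0} :=
    (measurableSet_eq_fun (hb.comp measurable_snd) measurable_const).union
      (measurableSet_eq_fun (ha.comp continuous_lorentzPerm_transvection.measurable)
        measurable_const)
  have h' : ∀ᵐ y : Hyp n, ∀ᵐ p : Hyp n,
      b y = 0 ∨ a (lorentzPerm (lorentzTransvection p) y) = 0 :=
    -- Fubini exchanges "for all `p`, almost every `y`" for "for almost every `y`, almost every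
    -- `p`", so a single good `y` can be fixed.
    (MeasureTheory.Measure.ae_ae_comm hmeas).1 (Filter.Eventually.of_forall h)
  obtain ⟨y, hy, hy'⟩ := ((Filter.not_eventually.1 hb0).and_eventually h').exists
  have hnull : MeasureTheory.volume
      {p : Hyp n | ¬ (b y = 0 ∨ a (lorentzPerm (lorentzTransvection p) y) = 0)} = 0 :=
    MeasureTheory.ae_iff.1 hy'
  -- Source and target have the same dimension, so a differentiable map preserves null sets. By
  -- surjectivity of `p ↦ ψ_p y`, the image of the exceptional parameters covers every `z` with `a z
  -- ≠ 0`.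
  have himg := MeasureTheory.addHaar_image_eq_zero_of_differentiableOn_of_addHaar_eq_zero
    MeasureTheory.volume (differentiable_lorentzPerm_transvection y).differentiableOn hnull
  refine MeasureTheory.ae_iff.2 (MeasureTheory.measure_mono_null (fun z hz => ?_) himg)
  obtain ⟨p, hp⟩ := exists_lorentzPerm_transvection_eq y z
  refine ⟨p, ?_, hp⟩
  rw [Set.mem_ofPred_eq, hp]
  exact not_or.2 ⟨hy, hz⟩

/-- For fixed `ψ`, the inner products over all supertranslations are the integrals of `a(ψ y) · conj
b(y)` against every smooth phase, so this product vanishes almost everywhere. -/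
theorem ae_eq_zero_or_of_forall_inner_pullL2 {m : ℝ} (hm : 0 < m) {a b : MassiveL2 m n}
    (h : ∀ F : SPI n, inner ℂ b (pullL2 hm F a) = 0) {ψ : Equiv.Perm (Hyp n)}
    (hψ : IsOrientedIsometry ψ) : ∀ᵐ y ∂massMeasure m n, b y = 0 ∨ a (ψ y) = 0 := by
  have hinner : ∀ (g : Hyp n → ℝ) (hg : ContDiff ℝ ∞ g),
      (fun y => inner ℂ (b y) (pullL2 hm (fibredAut g ψ hg hψ) a y)) =ᵐ[massMeasure m n]
        fun y => (a (ψ y) * star (b y)) * Complex.exp (-(Complex.I * m * g y)) := by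
    intro g hg
    filter_upwards [coeFn_pullL2 hm (fibredAut g ψ hg hψ) a] with y hy
    rw [hy, shiftPhase, shift_eq (fibredAut_apply g ψ hg hψ),
      baseMap_eq (fibredAut_apply g ψ hg hψ), RCLike.inner_apply, starRingEnd_apply]
    ring
  -- For the zero supertranslation the integrand is an inner product of two `L²` functions.
  have hint : MeasureTheory.Integrable (fun y => a (ψ y) * star (b y)) (massMeasure m n) := by
    refine (MeasureTheory.L2.integrable_inner b
      (pullL2 hm (fibredAut (fun _ => 0) ψ contDiff_const hψ) a)).congr
      ((hinner (fun _ => 0) contDiff_const).trans (Filter.Eventually.of_forall fun y => ?_))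
    simp
  have h0 := ae_eq_zero_of_forall_integral_phase hm hint fun g hg => by
    rw [← MeasureTheory.integral_congr_ae (hinner g hg), ← MeasureTheory.L2.inner_def]
    exact h _
  filter_upwards [h0] with y hy
  rcases mul_eq_zero.1 hy with h1 | h1
  · exact Or.inr h1
  · exact Or.inl (star_eq_zero.1 h1)

theorem eq_zero_or_eq_zero_of_forall_inner_pullL2 {m : ℝ} (hm : 0 < m) {a b : MassiveL2 m n}
    (h : ∀ F : SPI n, inner ℂ b (pullL2 hm F a) = 0) : b = 0 ∨ a = 0 := by
  have hz : ∀ c : MassiveL2 m n, (∀ᵐ y : Hyp n, c y = 0) → c = 0 := fun c hc =>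
    (MeasureTheory.Lp.eq_zero_iff_ae_eq_zero).2 ((ae_massMeasure_iff hm).2 hc)
  exact (ae_eq_zero_or_ae_eq_zero_of_transvections (MeasureTheory.Lp.stronglyMeasurable a).measurable
    (MeasureTheory.Lp.stronglyMeasurable b).measurable fun p => (ae_massMeasure_iff hm).1
      (ae_eq_zero_or_of_forall_inner_pullL2 hm h
        (isOrientedIsometry_lorentzPerm (lorentzTransvection p)))).imp (hz b) (hz a)

theorem massiveRep_irreducible {m : ℝ} (hm : 0 < m) (K : Submodule ℂ (MassiveL2 m n))
    (hK : IsClosed (K : Set (MassiveL2 m n)))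
    (hinv : ∀ F : SPI n, ∀ a ∈ K, massiveRep hm F a ∈ K) : K = ⊥ ∨ K = ⊤ := by
  by_contra hc
  obtain ⟨hbot, htop⟩ := not_or.1 hc
  have : CompleteSpace K := hK.completeSpace_coe
  obtain ⟨a, haK, ha⟩ := Submodule.exists_mem_ne_zero_of_ne_bot hbot
  obtain ⟨b, hbK, hb⟩ := Submodule.exists_mem_ne_zero_of_ne_bot
    (mt Submodule.orthogonal_eq_bot_iff.1 htop)
  refine (eq_zero_or_eq_zero_of_forall_inner_pullL2 hm (a := a) (b := b) fun F => ?_).elim hb ha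
  have h := hinv F⁻¹ a haK
  rw [massiveRep_apply, inv_inv] at h
  exact (Submodule.mem_orthogonal' K b).1 hbK _ h

/-! ### The Poincaré group -/

/-- The Lorentz part of a Poincaré transformation. -/
def lorentzPart (g : Poincare n) : Lorentz n := ⟨g.1.linear, g.2⟩

/-- This identifies `g.1 0` as the translation part `T`. -/
theorem poincare_apply (g : Poincare n) (X : Mink n) : g.1 X = g.1.linear X + g.1 0 := by
  simpa using g.1.map_vadd 0 X

/-- The action of a Poincaré transformation on `Ti`. -/
def poincareMap (g : Poincare n) (p : Ti n) : Ti n :=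
  (p.1 - mink (g.1 0) (g.1.linear (momentum p.2)), lorentzPerm (lorentzPart g) p.2)

theorem momentum_lorentzPart (g : Poincare n) (y : Hyp n) :
    momentum (lorentzPerm (lorentzPart g) y) = g.1.linear (momentum y) :=
  momentum_lorentzPerm (lorentzPart g) y

theorem poincareMap_mul (g h : Poincare n) (p : Ti n) :
    poincareMap (g * h) p = poincareMap g (poincareMap h p) := by
  have h1 : ∀ X, (g * h).1.linear X = g.1.linear (h.1.linear X) := fun _ => rfl
  have h2 : (g * h).1 0 = g.1.linear (h.1 0) + g.1 0 := poincare_apply g (h.1 0)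
  refine Prod.ext ?_ ?_
  · simp only [poincareMap, momentum_lorentzPart, h1, h2, mink_add_left]
    have h3 : mink (g.1.linear (h.1 0)) (g.1.linear (h.1.linear (momentum p.2))) =
        mink (h.1 0) (h.1.linear (momentum p.2)) := g.2.1 _ _
    rw [h3]
    ring
  · simp only [poincareMap]
    rw [lorentzPerm_apply, lorentzPerm_apply, momentum_lorentzPart]
    rfl

theorem poincareMap_one (p : Ti n) : poincareMap 1 p = p := by
  refine Prod.ext ?_ rfl
  change p.1 - mink 0 (momentum p.2) = p.1
  simp [mink]

theorem contDiff_poincare_shift (g : Poincare n) :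
    ContDiff ℝ ∞ fun y : Hyp n => -mink (g.1 0) (g.1.linear (momentum y)) := by
  have h : (fun y : Hyp n => -mink (g.1 0) (g.1.linear (momentum y))) =
      LinearMap.toContinuousLinearMap
        (-(minkLin (g.1 0) ∘ₗ (g.1.linear : Mink n →ₗ[ℝ] Mink n))) ∘ momentum := by
    funext y
    rw [mink_comm]
    rfl
  rw [h]
  exact (ContinuousLinearMap.contDiff _).comp contDiff_momentum

/-- The embedding of the Poincaré group into the SPI group. -/
def poincareHom (n : ℕ) : Poincare n →* SPI n where
  toFun g := ⟨{ toFun := poincareMap g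
                invFun := poincareMap g⁻¹
                left_inv := fun p => by rw [← poincareMap_mul, inv_mul_cancel, poincareMap_one]
                right_inv := fun p => by rw [← poincareMap_mul, mul_inv_cancel, poincareMap_one] },
    isCarrollAut_of_fibred (contDiff_poincare_shift g)
      (isOrientedIsometry_lorentzPerm (lorentzPart g)) fun _ _ => rfl⟩
  map_one' := Subtype.ext (Equiv.ext poincareMap_one)
  map_mul' g h := Subtype.ext (Equiv.ext (poincareMap_mul g h))

theorem poincareHom_apply (g : Poincare n) (u : ℝ) (y : Hyp n) : (poincareHom n g).1 (u, y) =
    (u + -mink (g.1 0) (g.1.linear (momentum y)), lorentzPerm (lorentzPart g) y) := rfl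

/-- Linear maps that agree on the hyperboloid are equal. -/
theorem linearMap_ext_momentum {E : Type*} [AddCommGroup E] [Module ℝ E] {A B : Mink n →ₗ[ℝ] E}
    (h : ∀ y, A (momentum y) = B (momentum y)) : A = B := by
  have h0 : momentum (0 : Hyp n) = (1, 0) := by simp [momentum]
  refine LinearMap.ext fun X => ?_
  -- The hyperboloid spans: each vector differs from the point above its spatial part by a multiple
  -- of `P(0) = (1, 0)`.
  have hX : X = momentum X.2 + (X.1 - (momentum X.2).1) • momentum 0 := by
    rw [h0]
    refine Prod.ext ?_ ?_ <;> simp [momentum]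
  rw [hX, map_add, map_add, map_smul, map_smul, h, h]

/-- If `g` acts trivially, its linear part fixes the hyperboloid and `T` is orthogonal to it. The
hyperboloid spans and the form is nondegenerate, so `g` is the identity. -/
theorem poincareHom_injective : Function.Injective (poincareHom n) := by
  refine (injective_iff_map_eq_one _).2 fun g hg => ?_
  have h : ∀ y, ((0 : ℝ) + -mink (g.1 0) (g.1.linear (momentum y)),
      lorentzPerm (lorentzPart g) y) = ((0 : ℝ), y) := fun y =>
    congrArg (fun F : SPI n => F.1 (0, y)) hg
  have hL : ∀ y, g.1.linear (momentum y) = momentum y := fun y => by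
    have h' : lorentzPerm (lorentzPart g) y = y := congrArg Prod.snd (h y)
    rw [← momentum_lorentzPart, h']
  have hlin : (g.1.linear : Mink n →ₗ[ℝ] Mink n) = LinearMap.id := linearMap_ext_momentum hL
  have hT : minkLin (g.1 0) = 0 := linearMap_ext_momentum fun y => by
    have := (Prod.ext_iff.1 (h y)).1
    rw [hL] at this
    rw [minkLin_apply, mink_comm]
    simpa using this
  have h1 : (g.1 0).1 = 0 := by
    have := LinearMap.congr_fun hT (1, 0)
    simpa [minkLin_apply, mink] using this
  have h2 : (g.1 0).2 = 0 := by
    have := LinearMap.congr_fun hT (0, (g.1 0).2)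
    simpa [minkLin_apply, mink] using this
  refine Subtype.ext (AffineEquiv.ext fun X => ?_)
  rw [poincare_apply, show g.1 0 = 0 from Prod.ext h1 h2, add_zero]
  exact LinearMap.congr_fun hlin X

theorem poincare_inv_zero (g : Poincare n) : (g⁻¹).1 0 = -(g.1.linear.symm (g.1 0)) := by
  have h : g.1 ((g⁻¹).1 0) = 0 := g.1.apply_symm_apply 0
  rw [poincare_apply] at h
  rw [← map_neg, LinearEquiv.eq_symm_apply]
  exact eq_neg_of_add_eq_zero_left h

theorem poincareHom_inv_apply (g : Poincare n) (u : ℝ) (y : Hyp n) :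
    (poincareHom n g⁻¹).1 (u, y) =
      (u + mink (g.1 0) (momentum y), lorentzPerm (lorentzPart g⁻¹) y) := by
  rw [poincareHom_apply, poincare_inv_zero]
  have h1 : (g⁻¹).1.linear (momentum y) = g.1.linear.symm (momentum y) := rfl
  have h2 : mink (-(g.1.linear.symm (g.1 0))) (g.1.linear.symm (momentum y)) =
      -mink (g.1 0) (momentum y) := by
    have h3 := (g⁻¹).2.1 (g.1 0) (momentum y)
    change mink (g.1.linear.symm (g.1 0)) (g.1.linear.symm (momentum y)) = _ at h3
    rw [← h3, ← neg_one_smul ℝ, mink_smul_left, neg_one_mul]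
  rw [h1, h2, neg_neg]

theorem massiveRep_poincareHom {m : ℝ} (hm : 0 < m) (g : Poincare n) (a : MassiveL2 m n) :
    massiveRep hm (poincareHom n g) a =ᵐ[massMeasure m n] fun y =>
      Complex.exp (-(Complex.I * m * mink (g.1 0) (momentum y))) *
        a (g.1.linear.symm (momentum y)).2 := by
  have h := massiveRep_inv_ae_eq hm (poincareHom_inv_apply g) a
  rw [← map_inv, inv_inv] at h
  filter_upwards [h] with y hy
  rw [hy, mul_comm]
  rfl

/-- Substituting `k = Λ⁻¹ y` preserves the measure, and `P(Λ⁻¹ y) · g⁻¹X = P(y) · X - T · P(y)`. The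
last term is exactly the phase in the representation, and its conjugate serves the second summand.
-/
theorem massiveField_massiveRep {m : ℝ} (hm : 0 < m) (g : Poincare n) (a : MassiveL2 m n)
    (X : Mink n) : massiveField m (massiveRep hm (poincareHom n g) a) X =
      massiveField m a (g.1.symm X) := by
  set ψ := lorentzPerm (lorentzPart g⁻¹) with hψ_def
  have hψ := isOrientedIsometry_lorentzPerm (lorentzPart g⁻¹)
  have hemb : MeasurableEmbedding ψ :=
    (MeasurableEquiv.mk ψ hψ.smooth.continuous.measurable
      hψ.smooth_symm.continuous.measurable).measurableEmbedding
  rw [massiveField, massiveField, ← (hψ.measurePreserving hm).integral_comp hemb fun k =>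
    a k * Complex.exp (Complex.I * m * mink (momentum k) (g.1.symm X)) +
      star (a k) * Complex.exp (-(Complex.I * m * mink (momentum k) (g.1.symm X)))]
  refine MeasureTheory.integral_congr_ae ?_
  filter_upwards [massiveRep_poincareHom hm g a] with y hy
  have hX : mink (momentum (ψ y)) (g.1.symm X) = mink (momentum y) X -
      mink (g.1 0) (momentum y) := by
    have h1 : g.1.linear (momentum (ψ y)) = momentum y := by
      rw [hψ_def, momentum_lorentzPart]
      exact g.1.linear.apply_symm_apply _
    have h2 : g.1.linear (g.1.symm X) = X - g.1 0 := by
      rw [eq_sub_iff_add_eq, ← poincare_apply, AffineEquiv.apply_symm_apply]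
    rw [← g.2.1 (momentum (ψ y)) (g.1.symm X)]
    change mink (g.1.linear (momentum (ψ y))) (g.1.linear (g.1.symm X)) = _
    rw [h1, h2, mink_sub_right, mink_comm (momentum y) (g.1 0)]
  have hstar : star (Complex.exp (-(Complex.I * m * mink (g.1 0) (momentum y)))) =
      Complex.exp (Complex.I * m * mink (g.1 0) (momentum y)) := by
    rw [← starRingEnd_apply, ← Complex.exp_conj]
    simp
  rw [hy, hX, star_mul, hstar]
  change _ * a (ψ y) * _ + star (a (ψ y)) * _ * _ = _
  have e1 : Complex.exp (Complex.I * m * ((mink (momentum y) X - mink (g.1 0) (momentum y) : ℝ)))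
      = Complex.exp (-(Complex.I * m * mink (g.1 0) (momentum y))) *
        Complex.exp (Complex.I * m * mink (momentum y) X) := by
    rw [← Complex.exp_add]
    push_cast
    congr 1
    ring
  have e2 : Complex.exp (-(Complex.I * m *
      ((mink (momentum y) X - mink (g.1 0) (momentum y) : ℝ))))
      = Complex.exp (Complex.I * m * mink (g.1 0) (momentum y)) *
        Complex.exp (-(Complex.I * m * mink (momentum y) X)) := by
    rw [← Complex.exp_add]
    push_cast
    congr 1
    ring
  rw [e1, e2]
  ring

end SpiMassive

end

theorem mainTheorem10 (n : ℕ) (m : ℝ) (hm : 0 < m) :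
    -- the SPI group consists of the maps `(u, y) ↦ (u + w(y), y'(y))`
    (∀ F : Equiv.Perm (SpiMassive.Ti n), F ∈ SpiMassive.SPI n ↔
      ∃ (w : SpiMassive.Hyp n → ℝ) (ψ : Equiv.Perm (SpiMassive.Hyp n)),
        ContDiff ℝ ∞ w ∧ SpiMassive.IsOrientedIsometry ψ ∧
          ∀ u y, F (u, y) = (u + w y, ψ y)) ∧
    -- scattering data are the equivariant functions, and determine the Fourier coefficients
    (∀ φ : SpiMassive.Ti n → ℂ, SpiMassive.IsEquivariantData m φ ↔
      ∃! a : SpiMassive.Hyp n → ℂ, φ = SpiMassive.scatteringData m a) ∧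
    -- the action on scattering data and on Fourier coefficients
    (∀ F ∈ SpiMassive.SPI n, ∀ (w : SpiMassive.Hyp n → ℝ) (ψ : Equiv.Perm (SpiMassive.Hyp n)),
      (∀ u y, F (u, y) = (u + w y, ψ y)) →
        (∀ φ u y, SpiMassive.pull F φ (u, y) = φ (u + w y, ψ y)) ∧
        (∀ φ, SpiMassive.IsEquivariantData m φ →
          SpiMassive.IsEquivariantData m (SpiMassive.pull F φ)) ∧
        ∀ a a' : SpiMassive.Hyp n → ℂ,
          SpiMassive.pull F (SpiMassive.scatteringData m a) = SpiMassive.scatteringData m a' ↔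
            ∀ y, a' y = a (ψ y) * Complex.exp (-(Complex.I * m * w y))) ∧
    -- the norm on the space of massive fields
    (∀ a : SpiMassive.MassiveL2 m n, ‖a‖ ^ 2 =
      m ^ ((n : ℝ) - 1) / (2 * (2 * Real.pi) ^ n) *
        ∫ k : SpiMassive.Hyp n, ‖a k‖ ^ 2 / Real.sqrt (1 + ‖k‖ ^ 2)) ∧
    -- the unitary irreducible representation, and the Poincaré group inside the SPI group
    ∃ (U : SpiMassive.SPI n →* (SpiMassive.MassiveL2 m n ≃ₗᵢ[ℂ] SpiMassive.MassiveL2 m n))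
      (ι : SpiMassive.Poincare n →* SpiMassive.SPI n),
      (∀ (F : SpiMassive.SPI n) (w : SpiMassive.Hyp n → ℝ) (ψ : Equiv.Perm (SpiMassive.Hyp n)),
        (∀ u y, F.1 (u, y) = (u + w y, ψ y)) → ∀ a : SpiMassive.MassiveL2 m n,
          U F⁻¹ a =ᵐ[SpiMassive.massMeasure m n]
            fun y => a (ψ y) * Complex.exp (-(Complex.I * m * w y))) ∧
      (∀ K : Submodule ℂ (SpiMassive.MassiveL2 m n), IsClosed (K : Set (SpiMassive.MassiveL2 m n)) →
        (∀ F, ∀ a ∈ K, U F a ∈ K) → K = ⊥ ∨ K = ⊤) ∧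
      Function.Injective ι ∧
      (∀ (g : SpiMassive.Poincare n) (u : ℝ) (y : SpiMassive.Hyp n),
        SpiMassive.momentum ((ι g).1 (u, y)).2 = g.1.linear (SpiMassive.momentum y) ∧
        ((ι g).1 (u, y)).1 =
          u - SpiMassive.mink (g.1 0) (g.1.linear (SpiMassive.momentum y))) ∧
      -- restricted to the Poincaré group, `U` is the usual massive representation
      (∀ (g : SpiMassive.Poincare n) (a : SpiMassive.MassiveL2 m n),
        U (ι g) a =ᵐ[SpiMassive.massMeasure m n] fun y =>
          Complex.exp (-(Complex.I * m * SpiMassive.mink (g.1 0) (SpiMassive.momentum y))) *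
            a (g.1.linear.symm (SpiMassive.momentum y)).2) ∧
      ∀ (g : SpiMassive.Poincare n) (a : SpiMassive.MassiveL2 m n),
        MeasureTheory.Integrable a (SpiMassive.massMeasure m n) → ∀ X : SpiMassive.Mink n,
          SpiMassive.massiveField m (U (ι g) a) X =
            SpiMassive.massiveField m a (g.1.symm X) := by
  refine ⟨SpiMassive.mem_SPI_iff, SpiMassive.isEquivariantData_iff hm, ?_,
    SpiMassive.norm_sq_massiveL2 hm, SpiMassive.massiveRep hm, SpiMassive.poincareHom n, ?_,
    SpiMassive.massiveRep_irreducible hm, SpiMassive.poincareHom_injective, ?_,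
    SpiMassive.massiveRep_poincareHom hm,
    fun g a _ X => SpiMassive.massiveField_massiveRep hm g a X⟩
  · intro F _ w ψ h
    exact ⟨fun φ u y => congrArg φ (h u y), fun φ hφ => hφ.pull h,
      SpiMassive.pull_scatteringData_eq_iff hm h⟩
  · intro F w ψ h a
    exact SpiMassive.massiveRep_inv_ae_eq hm h a
  · intro g u y
    exact ⟨SpiMassive.momentum_lorentzPart g y, rfl⟩
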